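/- **Proposition.** Let $D$ be a plane diagram of an oriented link $L$ with $m$ components. Let $A=\mathbb Q[t]\cdot 1\oplus\mathbb Q[t]\cdot X$ be the Frobenius algebra over $\mathbb Q[t]$ with $$X^2=t,\quad \epsilon(1)=0,\quad \epsilon(X)=1,\quad \Delta(1)=1\otimes X+X\otimes 1,\quad \Delta(X)=X\otimes X+t\,1\otimes 1 .$$ Let $C_t(D)$ be the complex of free $\mathbb Q[t]$-modules that Khovanov's construction assigns to $D$ and $A$: it is the total complex of the cube of resolutions of $D$, in which a smoothing with $k$ circles contributes $A^{\otimes k}$, each edge of the cube acts by the multiplication of $A$ where two circles merge and by $\Delta$ where a circle splits (with the usual signs), and the cohomological degree is the number of $1$-smoothings minus the number of negative crossings. Let $\mathrm H_t(D)$ be its total cohomology (the direct sum over all degrees), $\mathrm{Tor}(D)\subset \mathrm H_t(D)$ the $\mathbb Q[t]$-torsion submodule, and $\mathrm H'(D)=\mathrm H_t(D)/\mathrm{Tor}(D)$. Then $\mathrm H'(D)$ is a free $\mathbb Q[t]$-module of rank $2^m$. -/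

import Mathlib

noncomputable section

/-! ### Oriented link diagrams

A link diagram in the plane is recorded combinatorially. It has `n` crossings, and at each crossing
four ends of strands ("darts"), numbered `0, 1, 2, 3` counterclockwise, starting from the incoming
end of the under-strand. Hence the under-strand runs from `0` to `2`, and the over-strand joins `1`
and `3`; it runs from `3` to `1` at a positive crossing and from `1` to `3` at a negative one.
The arcs of the diagram are given by the involution that exchanges the two ends of each arc.
Circles of the diagram which meet no crossing are only counted. -/

namespace LinkDiagram

/-- The four strand ends at each of the `n` crossings. -/
abbrev Dart (n : ℕ) : Type := Fin n × Fin 4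

variable {n : ℕ}

/-- The next dart at the same crossing, counterclockwise. -/
def rot (d : Dart n) : Dart n := (d.1, d.2 + 1)

/-- The other end of the same strand at the same crossing. -/
def opp (d : Dart n) : Dart n := (d.1, d.2 + 2)

/-- Does the orientation of the link point away from the crossing at the dart `d`? The value
`positive c` is the sign of the crossing `c` (`true` for a positive crossing). -/
def IsOut (positive : Fin n → Bool) (d : Dart n) : Prop :=
  d.2 = 2 ∨ d.2 = (if positive d.1 then 1 else 3)

/-- The faces of the 4-valent ribbon graph: walk along an arc, then turn to the next dart. -/
abbrev Face (arc : Dart n → Dart n) : Type :=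
  Quot fun d d' : Dart n => d' = rot (arc d)

/-- The connected components of the 4-valent graph. -/
abbrev Piece (arc : Dart n → Dart n) : Type :=
  Quot fun d d' : Dart n => d' = arc d ∨ d' = rot d

end LinkDiagram

/-- An oriented link diagram in the plane. -/
structure LinkDiagram where
  /-- the number of crossings -/
  n : ℕ
  /-- the other end of the arc that starts at a given dart -/
  arc : LinkDiagram.Dart n → LinkDiagram.Dart n
  /-- the signs of the crossings -/
  positive : Fin n → Bool
  /-- the number of circles without crossings -/
  loops : ℕ
  arc_arc : ∀ d, arc (arc d) = d
  /-- Every arc leads from an outgoing dart to an incoming one. -/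
  oriented : ∀ d, LinkDiagram.IsOut positive (arc d) ↔ ¬ LinkDiagram.IsOut positive d
  /-- Euler's formula `V - E + F = 2 * (number of connected components)`, with `V = n` and
  `E = 2 * n`: all components of the ribbon graph have genus `0`, so the diagram is planar. -/
  planar : Nat.card (LinkDiagram.Face arc) = n + 2 * Nat.card (LinkDiagram.Piece arc)

namespace LinkDiagram

variable (D : LinkDiagram)

/-- The components of the link: follow the arcs, and go straight on at the crossings. -/
abbrev Component : Type :=
  (Quot fun d d' : Dart D.n => d' = D.arc d ∨ d' = opp d) ⊕ Fin D.loops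

/-- The number of components of the link. -/
def numComponents : ℕ := Nat.card D.Component

/-- The number of negative crossings. -/
def numNegative : ℕ := Nat.card {c : Fin D.n // D.positive c = false}

/-! ### The cube of resolutions -/

/-- A vertex of the cube: a choice of the `0`-smoothing (`false`) or the `1`-smoothing (`true`) at
each crossing. -/
abbrev Vertex : Type := Fin D.n → Bool

variable {D}

/-- The dart to which `d` gets connected at its crossing: the `0`-smoothing joins `0` with `1` and
`2` with `3`, the `1`-smoothing joins `0` with `3` and `1` with `2`. -/
def smooth (s : D.Vertex) (d : Dart D.n) : Dart D.n :=
  (d.1, if s d.1 then 3 - d.2 else 1 - d.2)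

/-- The circles into which the smoothing `s` turns the diagram. -/
abbrev Circle (s : D.Vertex) : Type :=
  (Quot fun d d' : Dart D.n => d' = D.arc d ∨ d' = smooth s d) ⊕ Fin D.loops

/-- The circle of the smoothing `s` that runs through a given dart. -/
def circleOf (s : D.Vertex) (d : Dart D.n) : Circle s :=
  Sum.inl (Quot.mk _ d)

variable (D) in
/-- Pairs of a vertex `s` and a map that assigns to each circle of `s` one of the two basis elements
`1` (`false`) and `X` (`true`) of the Frobenius algebra `A`. For fixed `s` these are the elements of
the standard basis of the tensor power of `A` over the circles of `s`. -/
abbrev EnhancedState : Type := Σ s : D.Vertex, (Circle s → Bool)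

/-- The cohomological degree: the number of `1`-smoothings minus the number of negative
crossings. -/
def degree (x : D.EnhancedState) : ℤ :=
  (Nat.card {c : Fin D.n // x.1 c = true} : ℤ) - (D.numNegative : ℤ)

/-! ### The Frobenius algebra

The free `R`-module `A = R1 ⊕ RX` with `X² = t`, `ε(1) = 0`, `ε(X) = 1`,
`Δ(1) = 1 ⊗ X + X ⊗ 1` and `Δ(X) = X ⊗ X + t 1 ⊗ 1`. The basis element `1` is written `false`, and
`X` is written `true`. -/

section Frobenius

variable {R : Type} [CommRing R] (t : R)

/-- The coefficient of the basis element `c` in the product `a * b`. -/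
def mulCoeff : Bool → Bool → Bool → R
  | false, false, false => 1
  | false, true, true => 1
  | true, false, true => 1
  | true, true, false => t
  | _, _, _ => 0

/-- The coefficient of the basis element `b ⊗ c` in `Δ a`. -/
def comulCoeff : Bool → Bool → Bool → R
  | false, false, true => 1
  | false, true, false => 1
  | true, true, true => 1
  | true, false, false => t
  | _, _, _ => 0

open Classical in
/-- The matrix entry from `x` to `y` of the map along the edge of the cube at the crossing `c`,
where `x.1` and `y.1` differ exactly in that `c` has the `0`-smoothing in `x.1` and the `1`-smoothing
in `y.1`. At `c` the two strands of either smoothing run through the darts `(c, 0)` and `(c, 2)`.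
The map is the identity on the factors that belong to circles which do not pass through `c`, it is
the multiplication if two circles merge at `c`, and `Δ` if a circle splits at `c`. (In a planar
diagram one of the two always happens.) -/
def edgeCoeff (c : Fin D.n) (x y : D.EnhancedState) : R :=
  if (∀ d : Dart D.n, circleOf x.1 d ≠ circleOf x.1 (c, 0) →
        circleOf x.1 d ≠ circleOf x.1 (c, 2) →
        y.2 (circleOf y.1 d) = x.2 (circleOf x.1 d)) ∧
      (∀ k : Fin D.loops, y.2 (Sum.inr k) = x.2 (Sum.inr k)) then
    if circleOf x.1 (c, 0) ≠ circleOf x.1 (c, 2) ∧ circleOf y.1 (c, 0) = circleOf y.1 (c, 2) then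
      mulCoeff t (x.2 (circleOf x.1 (c, 0))) (x.2 (circleOf x.1 (c, 2)))
        (y.2 (circleOf y.1 (c, 0)))
    else if circleOf x.1 (c, 0) = circleOf x.1 (c, 2) ∧
        circleOf y.1 (c, 0) ≠ circleOf y.1 (c, 2) then
      comulCoeff t (x.2 (circleOf x.1 (c, 0)))
        (y.2 (circleOf y.1 (c, 0))) (y.2 (circleOf y.1 (c, 2)))
    else 0
  else 0

/-- The matrix entry from `x` to `y` of the differential of the total complex: the sum over the edges
of the cube, with the sign `(-1) ^ #{j < c | j has the 1-smoothing}` for the edge at `c`. -/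
def incidence (x y : D.EnhancedState) : R :=
  ∑ c : Fin D.n,
    if x.1 c = false ∧ y.1 = Function.update x.1 c true then
      (-1) ^ Nat.card {j : Fin D.n // j < c ∧ x.1 j = true} * edgeCoeff t c x y
    else 0

end Frobenius

/-! ### The complex and its cohomology -/

variable (D)

/-- The basis of the cochain module in degree `i`. -/
abbrev Generator (i : ℤ) : Type := {x : D.EnhancedState // degree x = i}

instance (i : ℤ) : Fintype (D.Generator i) := Fintype.ofFinite _

/-- The cochain module in degree `i`, free on `Generator i`: the direct sum, over the vertices of the
cube in degree `i`, of the tensor powers of `A` over the circles. -/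
abbrev Cochain (R : Type) (i : ℤ) : Type := D.Generator i → R

section Cohomology

variable {R : Type} [CommRing R] (t : R)

/-- The component of the differential from degree `i` to degree `j` (zero unless `j = i + 1`). -/
def differential (i j : ℤ) : D.Cochain R i →ₗ[R] D.Cochain R j :=
  Matrix.mulVecLin (Matrix.of fun (y : D.Generator j) (x : D.Generator i) => incidence t x.1 y.1)

/-- The cohomology in degree `i`: cocycles modulo coboundaries. (Coboundaries are cocycles, because
the squares of the cube commute for a planar diagram; `submoduleOf` regards the module of coboundaries
as a submodule of the module of cocycles.) -/
def Cohomology (i : ℤ) : Type :=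
  LinearMap.ker (D.differential t i (i + 1)) ⧸
    (LinearMap.range (D.differential t (i - 1) i)).submoduleOf
      (LinearMap.ker (D.differential t i (i + 1)))

instance (i : ℤ) : AddCommGroup (D.Cohomology t i) :=
  inferInstanceAs (AddCommGroup (LinearMap.ker (D.differential t i (i + 1)) ⧸
    (LinearMap.range (D.differential t (i - 1) i)).submoduleOf
      (LinearMap.ker (D.differential t i (i + 1)))))

instance (i : ℤ) : Module R (D.Cohomology t i) :=
  inferInstanceAs (Module R (LinearMap.ker (D.differential t i (i + 1)) ⧸
    (LinearMap.range (D.differential t (i - 1) i)).submoduleOf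
      (LinearMap.ker (D.differential t i (i + 1)))))

open scoped DirectSum in
/-- The total cohomology, the direct sum over all cohomological degrees. -/
abbrev TotalCohomology : Type := ⨁ i : ℤ, D.Cohomology t i

end Cohomology

open Polynomial in
/-- `H_t(D)`: the cohomology of the complex over `ℚ[t]` given by `X² = t`. -/
abbrev Ht : Type := D.TotalCohomology (Polynomial.X : ℚ[X])

open Polynomial in
/-- `H'(D)`: the quotient of `H_t(D)` by its torsion submodule. -/
abbrev HPrime : Type := D.Ht ⧸ Submodule.torsion ℚ[X] D.Ht

end LinkDiagram

end

/-!
The rank of the cohomology over `ℚ[t]` can be computed after extending scalars to an algebraically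
closed field `K` that contains `ℚ[t]`. There `t` has a square root `r ≠ 0`, so that `A` becomes the
product `K × K`: the evaluations at `X = r` and `X = -r` diagonalize the multiplication, and also the
comultiplication, with eigenvalues `1` and `± 2 * r`. Dividing them by square roots of `± 2 * r` makes
the two sets of eigenvalues equal (`nonempty_diagonalBasis`).

In the resulting basis of the complex, a basis vector is a smoothing `s` together with a colouring of
the darts, and of the circles without crossings, by two colours that is constant along the circles of
`s`. Every edge of the cube, merge or
split, keeps the colours of all darts and multiplies by a nonzero scalar that depends only on the
colour at the crossing; it vanishes unless the two strands at the crossing have the same colour, that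
is, unless the crossing is free (`sum_tensorPower_mul_edgeCoeff`, `diagMatrix_mul_vertexMatrix`). So
for a fixed colouring the complex is a Koszul complex on the free crossings. The squares
anticommute, and if there is a free crossing, then the first one provides a contracting homotopy
(`diagMatrix_mul_self`, `diagMatrix_homotopy`). Hence the dimension of the cohomology is the number of
states without free crossings.

In such a state the colour changes between the two ends of a strand at each crossing, and the colours
determine the smoothing. These colourings form a torsor under the functions from the components of the
link to `ZMod 2`, so that there are `2 ^ m` of them as soon as there is one (`card_survivors`). One
arises from a checkerboard colouring of the plane and the orientation of the link
(`exists_canonicalColouring`).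

Planarity enters twice, both times through the checkerboard colouring (`exists_checkerboard`), whose
existence follows from Euler's formula by linear algebra over `ZMod 2`. Apart from the canonical
colouring, it yields that each edge of the cube merges two circles or splits one
(`circleOf_update_eq_iff`): the colouring orients all circles of all smoothings coherently, which makes
them the cycles of a permutation, and changing a smoothing multiplies this permutation by a
transposition.
-/


/-! ### Ranks -/

section Rank

/-- A splitting of the identity by a contracting homotopy `a, b` and a projection `p` that vanishes
on coboundaries makes `p` compute the dimension of the cohomology at `V`. -/
theorem finrank_eq_of_homotopy {K U V W : Type*} [Field K] [AddCommGroup U] [Module K U]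
    [AddCommGroup V] [Module K V] [AddCommGroup W] [Module K W] [FiniteDimensional K V]
    (e : U →ₗ[K] V) (d : V →ₗ[K] W) (p : V →ₗ[K] V) (a : V →ₗ[K] U) (b : W →ₗ[K] V)
    (h : ∀ v, e (a v) + b (d v) + p v = v) (hde : ∀ u, d (e u) = 0) (hpe : ∀ u, p (e u) = 0)
    (hdp : ∀ v, d (p v) = 0) (hpp : ∀ v, p (p v) = p v) :
    Module.finrank K V = Module.finrank K (LinearMap.range d) +
      Module.finrank K (LinearMap.range e) + Module.finrank K (LinearMap.range p) := by
  have hker : LinearMap.ker d = LinearMap.range e ⊔ LinearMap.range p := by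
    apply le_antisymm
    · intro v hv
      have := h v
      rw [LinearMap.mem_ker.1 hv, map_zero, add_zero] at this
      rw [← this]
      exact Submodule.add_mem_sup ⟨_, rfl⟩ ⟨_, rfl⟩
    · refine sup_le ?_ ?_
      · rintro _ ⟨u, rfl⟩
        exact hde u
      · rintro _ ⟨v, rfl⟩
        exact hdp v
  have hinf : LinearMap.range e ⊓ LinearMap.range p = ⊥ := by
    rw [eq_bot_iff]
    rintro x ⟨⟨u, rfl⟩, ⟨v, hv⟩⟩
    rw [Submodule.mem_bot, ← hv, ← hpp, hv, hpe]
  have h1 := Submodule.finrank_sup_add_finrank_inf_eq (LinearMap.range e) (LinearMap.range p)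
  rw [hinf, finrank_bot, add_zero, ← hker] at h1
  have h2 := LinearMap.finrank_range_add_finrank_ker d
  omega

open TensorProduct in
/-- The rank of a matrix over a domain does not change in an extension field. -/
theorem Matrix.rank_map_algebraMap {R K m n : Type*} [CommRing R] [IsDomain R] [Field K]
    [Algebra R K] [FaithfulSMul R K] [Module.Flat R K] [Fintype m] [Fintype n]
    (A : Matrix m n R) : (A.map (algebraMap R K)).rank = A.rank := by
  classical
  rw [Matrix.rank_eq_finrank_span_cols, Matrix.rank_eq_finrank_span_cols]
  set p := Submodule.span R (Set.range A.col)
  rw [← (TensorProduct.isBaseChange R p K).finrank_eq,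
    (Submodule.toBaseChange.toLinearEquiv K p).finrank_eq,
    ← LinearEquiv.finrank_map_eq (TensorProduct.piScalarRight R K K m), Submodule.baseChange_span,
    Submodule.map_span, Set.image_image, ← Set.range_comp]
  have hcol : (A.map (algebraMap R K)).col = (fun x => (TensorProduct.piScalarRight R K K m)
      (TensorProduct.mk R K (m → R) 1 x)) ∘ A.col := by
    ext j i
    simp [Matrix.col, Algebra.algebraMap_eq_smul_one]
    rfl
  rw [hcol]
  rfl

open DirectSum in
/-- Over a domain, the rank of a direct sum is the sum of the ranks, without any freeness
assumption. -/
theorem rank_directSum_of_isDomain {R : Type} [CommRing R] [IsDomain R] {ι : Type}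
    (M : ι → Type) [∀ i, AddCommGroup (M i)] [∀ i, Module R (M i)] :
    Module.rank R (⨁ i, M i) = Cardinal.sum fun i => Module.rank R (M i) := by
  classical
  have h : ∀ (N : Type) [AddCommGroup N] [Module R N],
      Module.rank (FractionRing R) (TensorProduct R (FractionRing R) N) = Module.rank R N :=
    fun N => (TensorProduct.isBaseChange R N (FractionRing R)).rank_eq
  have h2 := rank_directSum (R := FractionRing R)
    (fun i => TensorProduct R (FractionRing R) (M i))
  simp_rw [h] at h2
  rw [← h, ← h2]
  exact (TensorProduct.directSumRight R (FractionRing R) (FractionRing R) M).rank_eq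

open DirectSum in
theorem DirectSum.finite_of_finite_nontrivial {R ι : Type*} [CommRing R] (M : ι → Type*)
    [∀ i, AddCommGroup (M i)] [∀ i, Module R (M i)] [∀ i, Module.Finite R (M i)]
    (s : Finset ι) (hs : ∀ i ∉ s, Subsingleton (M i)) : Module.Finite R (⨁ i, M i) := by
  classical
  refine ⟨?_⟩
  have h : (⊤ : Submodule R (⨁ i, M i)) =
      ⨆ i ∈ s, LinearMap.range (DFinsupp.lsingle (R := R) (M := M) i) := by
    rw [eq_comm, eq_top_iff]
    refine (DFinsupp.iSup_range_lsingle (R := R) (M := M)).ge.trans (iSup_le fun i => ?_)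
    by_cases hi : i ∈ s
    · exact le_biSup (fun i => LinearMap.range (DFinsupp.lsingle (R := R) (M := M) i)) hi
    · rintro _ ⟨x, rfl⟩
      have := hs i hi
      rw [Subsingleton.elim x 0, map_zero]
      exact zero_mem _
  rw [h]
  exact Submodule.fg_biSup s _ fun i _ =>
    (LinearMap.range_eq_map (DFinsupp.lsingle (R := R) (M := M) i)) ▸ Module.Finite.fg_top.map _

/-- The rank of cocycles modulo coboundaries. -/
theorem rank_ker_quotient_range {R U V W : Type} [CommRing R] [IsDomain R] [AddCommGroup U]
    [Module R U] [AddCommGroup V] [Module R V] [AddCommGroup W] [Module R W]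
    [Module.Finite R V] [IsNoetherianRing R] (e : U →ₗ[R] V) (d : V →ₗ[R] W) (k : ℕ)
    (hde : d ∘ₗ e = 0) (hk : Module.finrank R V = Module.finrank R (LinearMap.range d) +
      Module.finrank R (LinearMap.range e) + k) :
    Module.rank R (LinearMap.ker d ⧸
      (LinearMap.range e).submoduleOf (LinearMap.ker d)) = k := by
  have hle : LinearMap.range e ≤ LinearMap.ker d := LinearMap.range_le_ker_iff.2 hde
  have h1 := Submodule.finrank_quotient_add_finrank
    ((LinearMap.range e).submoduleOf (LinearMap.ker d))
  rw [(Submodule.submoduleOfEquivOfLe hle).finrank_eq] at h1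
  have h2 := Submodule.finrank_quotient_add_finrank (LinearMap.ker d)
  rw [d.quotKerEquivRange.finrank_eq] at h2
  rw [← Module.finrank_eq_rank]
  congr 1
  omega

end Rank

/-! ### Graded matrices -/

section Graded

variable {G : Type*} (deg : G → ℤ) {K : Type*}

/-- The block of a matrix from the basis elements of degree `i` to those of degree `j`. -/
def gradedBlock (A : Matrix G G K) (j i : ℤ) : Matrix {x // deg x = j} {x // deg x = i} K :=
  A.submatrix Subtype.val Subtype.val

/-- The matrix `A` raises the degree by `k`. -/
def IsHomogeneousMatrix [Zero K] (A : Matrix G G K) (k : ℤ) : Prop :=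
  ∀ z x, A z x ≠ 0 → deg z = deg x + k

variable {deg}

theorem gradedBlock_mul [CommRing K] [Fintype G] [∀ i, Fintype {x // deg x = i}]
    (A : Matrix G G K) {B : Matrix G G K} {k : ℤ} (hB : IsHomogeneousMatrix deg B k)
    (l : ℤ) {i j : ℤ} (hj : j = i + k) :
    gradedBlock deg (A * B) l i = gradedBlock deg A l j * gradedBlock deg B j i := by
  ext x y
  simp only [gradedBlock, Matrix.submatrix_apply, Matrix.mul_apply]
  refine (Fintype.sum_of_injective Subtype.val Subtype.val_injective _ _ ?_ fun _ => rfl).symm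
  intro z hz
  have : B z y = 0 := by
    by_contra h
    exact hz ⟨⟨z, by rw [hB _ _ h, y.2, hj]⟩, rfl⟩
  rw [this, mul_zero]

theorem IsHomogeneousMatrix.mul [CommRing K] [Fintype G] {A B : Matrix G G K} {k l : ℤ}
    (hA : IsHomogeneousMatrix deg A k) (hB : IsHomogeneousMatrix deg B l) :
    IsHomogeneousMatrix deg (A * B) (l + k) := by
  intro z x h
  obtain ⟨y, -, hy⟩ := Finset.exists_ne_zero_of_sum_ne_zero h
  rw [hA _ _ (left_ne_zero_of_mul hy), hB _ _ (right_ne_zero_of_mul hy), add_assoc]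

/-- The dimension count of `finrank_eq_of_homotopy` in each degree of a complex `A` with a homotopy
`H` from the identity to an idempotent `Q`. -/
theorem card_eq_rank_add_rank_add_rank [Field K] [Fintype G] [DecidableEq G]
    [∀ i, Fintype {x // deg x = i}] {A H Q : Matrix G G K}
    (hA : IsHomogeneousMatrix deg A 1) (hH : IsHomogeneousMatrix deg H (-1))
    (hQ : IsHomogeneousMatrix deg Q 0) (hAA : A * A = 0) (hh : A * H + H * A + Q = 1)
    (hQA : Q * A = 0) (hAQ : A * Q = 0) (hQQ : Q * Q = Q) (i : ℤ) :
    Fintype.card {x // deg x = i} = (gradedBlock deg A (i + 1) i).rank +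
      (gradedBlock deg A i (i - 1)).rank + (gradedBlock deg Q i i).rank := by
  rw [← Module.finrank_fintype_fun_eq_card K]
  have h1 : gradedBlock deg A i (i - 1) * gradedBlock deg H (i - 1) i +
      gradedBlock deg H i (i + 1) * gradedBlock deg A (i + 1) i + gradedBlock deg Q i i = 1 := by
    rw [← gradedBlock_mul A hH i (by ring), ← gradedBlock_mul H hA i rfl]
    have := congrArg (fun B => gradedBlock deg B i i) hh
    refine Eq.trans ?_ (this.trans ?_)
    · rfl
    · exact Matrix.submatrix_one _ Subtype.val_injective
  have h2 : gradedBlock deg A (i + 1) i * gradedBlock deg A i (i - 1) = 0 := by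
    rw [← gradedBlock_mul A hA _ (by ring), hAA]; rfl
  have h3 : gradedBlock deg Q i i * gradedBlock deg A i (i - 1) = 0 := by
    rw [← gradedBlock_mul Q hA _ (by ring), hQA]; rfl
  have h4 : gradedBlock deg A (i + 1) i * gradedBlock deg Q i i = 0 := by
    rw [← gradedBlock_mul A hQ _ (by ring), hAQ]; rfl
  have h5 : gradedBlock deg Q i i * gradedBlock deg Q i i = gradedBlock deg Q i i := by
    rw [← gradedBlock_mul Q hQ _ (by ring), hQQ]
  refine finrank_eq_of_homotopy (gradedBlock deg A i (i - 1)).mulVecLin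
    (gradedBlock deg A (i + 1) i).mulVecLin (gradedBlock deg Q i i).mulVecLin
    (gradedBlock deg H (i - 1) i).mulVecLin (gradedBlock deg H i (i + 1)).mulVecLin ?_ ?_ ?_ ?_ ?_
  · intro v
    simp only [Matrix.mulVecLin_apply, Matrix.mulVec_mulVec, ← Matrix.add_mulVec, h1,
      Matrix.one_mulVec]
  · intro v
    simp only [Matrix.mulVecLin_apply, Matrix.mulVec_mulVec, h2, Matrix.zero_mulVec]
  · intro v
    simp only [Matrix.mulVecLin_apply, Matrix.mulVec_mulVec, h3, Matrix.zero_mulVec]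
  · intro v
    simp only [Matrix.mulVecLin_apply, Matrix.mulVec_mulVec, h4, Matrix.zero_mulVec]
  · intro v
    simp only [Matrix.mulVecLin_apply, Matrix.mulVec_mulVec, h5]

end Graded

/-! ### The checkerboard colouring -/

namespace LinkDiagram

section Checkerboard

variable {n : ℕ}

/-- The functions that are pulled back from a quotient are those that respect the relation. -/
theorem mem_range_funLeft_quot {X : Type} {r : X → X → Prop} {w : X → ZMod 2} :
    w ∈ LinearMap.range (LinearMap.funLeft (ZMod 2) (ZMod 2) (Quot.mk r)) ↔
      ∀ x y, r x y → w x = w y := by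
  constructor
  · rintro ⟨φ, rfl⟩ x y h
    simp only [LinearMap.funLeft_apply]
    rw [Quot.sound h]
  · intro h
    exact ⟨Quot.lift w h, rfl⟩

theorem finrank_range_funLeft_quot {X : Type} [Finite X] (r : X → X → Prop) :
    Module.finrank (ZMod 2) (LinearMap.range (LinearMap.funLeft (ZMod 2) (ZMod 2) (Quot.mk r))) =
      Nat.card (Quot r) := by
  have := Fintype.ofFinite (Quot r)
  rw [LinearMap.finrank_range_of_inj
    (LinearMap.funLeft_injective_of_surjective _ _ _ Quot.mk_surjective),
    Module.finrank_fintype_fun_eq_card, Nat.card_eq_fintype_card]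

/-- The sum of a function on the darts over the two ends of each arc. -/
def arcSum (arc : Dart n → Dart n) : (Dart n → ZMod 2) →ₗ[ZMod 2] (Dart n → ZMod 2) :=
  LinearMap.id + LinearMap.funLeft (ZMod 2) (ZMod 2) arc

/-- The sum of a function on the darts over the four ends at each crossing. -/
def crossingSum : (Dart n → ZMod 2) →ₗ[ZMod 2] (Fin n → ZMod 2) where
  toFun u c := ∑ i, u (c, i)
  map_add' u v := by ext c; simp [Finset.sum_add_distrib]
  map_smul' a u := by ext c; simp [Finset.mul_sum]

theorem arcSum_apply (arc : Dart n → Dart n) (u : Dart n → ZMod 2) (d : Dart n) :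
    arcSum arc u d = u d + u (arc d) := rfl

theorem crossingSum_apply (u : Dart n → ZMod 2) (c : Fin n) :
    crossingSum u c = ∑ i, u (c, i) := rfl

theorem eq_of_add_eq_zero_zmod_two {a b : ZMod 2} (h : a + b = 0) : a = b := by
  revert a b; decide

open Classical in
theorem isOut_ite_add (D : LinkDiagram) (d : Dart D.n) :
    ((if IsOut D.positive d then 1 else 0) + (if IsOut D.positive (D.arc d) then 1 else 0) :
      ZMod 2) = 1 := by
  by_cases h : IsOut D.positive d <;> simp [D.oriented, h]

/-- Every arc has two distinct ends, so the functions on the arcs have dimension `2 * n`. -/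
theorem finrank_range_arcSum (D : LinkDiagram) :
    Module.finrank (ZMod 2) (LinearMap.range (arcSum D.arc)) = 2 * D.n := by
  classical
  have h : LinearMap.ker (arcSum D.arc) = LinearMap.range (arcSum D.arc) := by
    apply le_antisymm
    · intro u hu
      have hu' : ∀ d, u d = u (D.arc d) := fun d =>
        eq_of_add_eq_zero_zmod_two (congrFun (LinearMap.mem_ker.1 hu) d)
      refine ⟨fun d => if IsOut D.positive d then u d else 0, ?_⟩
      ext d
      have := D.oriented d
      rw [arcSum_apply]
      by_cases h : IsOut D.positive d <;> simp [this, h, ← hu']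
    · rintro _ ⟨u, rfl⟩
      ext d
      simp only [arcSum_apply, D.arc_arc, Pi.zero_apply]
      rw [add_comm (u (D.arc d)), CharTwo.add_self_eq_zero]
  have h1 := LinearMap.finrank_range_add_finrank_ker (arcSum D.arc)
  rw [h, Module.finrank_fintype_fun_eq_card, Fintype.card_prod, Fintype.card_fin,
    Fintype.card_fin] at h1
  omega

theorem crossing_eq_of_rot_invariant {X : Type*} {w : Dart n → X} (h : ∀ d, w d = w (rot d))
    (d : Dart n) : w d = w (d.1, 0) := by
  obtain ⟨c, i⟩ := d
  have h0 := h (c, 0)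
  have h1 := h (c, 1)
  have h2 := h (c, 2)
  simp only [rot, zero_add] at h0 h1 h2
  have e1 : (1 + 1 : Fin 4) = 2 := rfl
  have e2 : (2 + 1 : Fin 4) = 3 := rfl
  rw [e1] at h1
  rw [e2] at h2
  fin_cases i
  · rfl
  · exact h0.symm
  · exact (h0.trans h1).symm
  · exact ((h0.trans h1).trans h2).symm

/-- The boundary map from arcs to crossings has corank the number of connected components. Its
transpose is the coboundary map from crossings to arcs. -/
theorem finrank_range_crossingSum_arcSum (D : LinkDiagram) :
    Module.finrank (ZMod 2) (LinearMap.range (crossingSum ∘ₗ arcSum D.arc)) +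
      Nat.card (Piece D.arc) = D.n := by
  classical
  set M : Matrix (Fin D.n) (Dart D.n) (ZMod 2) := Matrix.of fun c d =>
    (if d.1 = c then 1 else 0) + (if (D.arc d).1 = c then 1 else 0) with hM
  have hST : M.mulVecLin = crossingSum ∘ₗ arcSum D.arc := by
    refine LinearMap.ext fun u => funext fun c => ?_
    have h1 : ∀ f : Dart D.n → ZMod 2,
        ∑ i, f (c, i) = ∑ d : Dart D.n, if d.1 = c then f d else 0 := by
      intro f
      rw [Fintype.sum_prod_type, Finset.sum_eq_single c]
      · simp
      · intro b _ hb
        simp [hb]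
      · simp
    have h2 : (∑ d : Dart D.n, if d.1 = c then u (D.arc d) else 0) =
        ∑ d : Dart D.n, if (D.arc d).1 = c then u d else 0 := by
      have := Equiv.sum_comp (Function.Involutive.toPerm D.arc D.arc_arc)
        fun d : Dart D.n => if (D.arc d).1 = c then u d else 0
      refine Eq.trans (Finset.sum_congr rfl fun d _ => ?_) this
      change _ = if (D.arc (D.arc d)).1 = c then u (D.arc d) else 0
      rw [D.arc_arc]
    rw [LinearMap.comp_apply, crossingSum_apply]
    simp only [arcSum_apply]
    rw [Finset.sum_add_distrib, h1, h1 fun d => u (D.arc d), h2, ← Finset.sum_add_distrib]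
    simp only [hM, Matrix.mulVecLin_apply, Matrix.mulVec, dotProduct, Matrix.of_apply, add_mul,
      ite_mul, one_mul, zero_mul]
  have hMT : ∀ v d, M.transpose.mulVecLin v d = v d.1 + v (D.arc d).1 := by
    intro v d
    simp only [hM, Matrix.mulVecLin_apply, Matrix.mulVec, dotProduct, Matrix.transpose_apply,
      Matrix.of_apply, add_mul, ite_mul, one_mul, zero_mul, Finset.sum_add_distrib,
      Finset.sum_ite_eq, Finset.mem_univ, if_true]
  have hker : (LinearMap.ker M.transpose.mulVecLin).map
      (LinearMap.funLeft (ZMod 2) (ZMod 2) (Prod.fst : Dart D.n → Fin D.n)) =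
      LinearMap.range (LinearMap.funLeft (ZMod 2) (ZMod 2)
        (Quot.mk fun d d' : Dart D.n => d' = D.arc d ∨ d' = rot d)) := by
    ext w
    rw [mem_range_funLeft_quot]
    constructor
    · rintro ⟨v, hv, rfl⟩ d d' (rfl | rfl)
      · have := congrFun (LinearMap.mem_ker.1 hv) d
        rw [hMT] at this
        exact eq_of_add_eq_zero_zmod_two this
      · rfl
    · intro h
      have hw := crossing_eq_of_rot_invariant fun d => h d _ (Or.inr rfl)
      refine ⟨fun c => w (c, 0), ?_, ?_⟩
      · refine LinearMap.mem_ker.2 (funext fun d => ?_)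
        rw [hMT, ← hw, ← hw, ← h d _ (Or.inl rfl)]
        exact CharTwo.add_self_eq_zero _
      · ext d
        exact (hw d).symm
  have hinj : Function.Injective
      (LinearMap.funLeft (ZMod 2) (ZMod 2) (Prod.fst : Dart D.n → Fin D.n)) :=
    LinearMap.funLeft_injective_of_surjective _ _ _ Prod.fst_surjective
  have h1 := LinearMap.finrank_range_add_finrank_ker M.transpose.mulVecLin
  rw [(Submodule.equivMapOfInjective _ hinj _).finrank_eq, hker, finrank_range_funLeft_quot,
    Module.finrank_fintype_fun_eq_card, Fintype.card_fin] at h1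
  change _ + Nat.card (Piece D.arc) = D.n at h1
  have h2 : M.transpose.rank = M.rank := M.rank_transpose
  rw [← hST]
  exact (congrArg (· + _) h2.symm).trans h1

/-- The coboundary map from faces to arcs has the number of connected components as its nullity. -/
theorem finrank_range_arcSum_face (D : LinkDiagram) :
    Module.finrank (ZMod 2) (LinearMap.range (arcSum D.arc ∘ₗ LinearMap.funLeft (ZMod 2) (ZMod 2)
      (Quot.mk fun d d' : Dart D.n => d' = rot (D.arc d)))) + Nat.card (Piece D.arc) =
      Nat.card (Face D.arc) := by
  classical
  set p := LinearMap.funLeft (ZMod 2) (ZMod 2)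
      (Quot.mk fun d d' : Dart D.n => d' = rot (D.arc d)) with hp
  have hker : (LinearMap.ker (arcSum D.arc ∘ₗ p)).map p =
      LinearMap.range (LinearMap.funLeft (ZMod 2) (ZMod 2)
        (Quot.mk fun d d' : Dart D.n => d' = D.arc d ∨ d' = rot d)) := by
    ext w
    rw [mem_range_funLeft_quot]
    constructor
    · rintro ⟨φ, hφ, rfl⟩
      have h1 : ∀ d, p φ d = p φ (D.arc d) := fun d =>
        eq_of_add_eq_zero_zmod_two (congrFun (LinearMap.mem_ker.1 hφ) d)
      have h2 := mem_range_funLeft_quot.1 ⟨φ, rfl⟩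
      rintro d d' (rfl | rfl)
      · exact h1 d
      · have := h2 (D.arc d) _ rfl
        rw [D.arc_arc] at this
        exact (h1 d).trans this
    · intro h
      obtain ⟨φ, rfl⟩ : w ∈ LinearMap.range p := mem_range_funLeft_quot.2 (by
        rintro d _ rfl
        exact (h d _ (Or.inl rfl)).trans (h _ _ (Or.inr rfl)))
      refine ⟨φ, LinearMap.mem_ker.2 (funext fun d => ?_), rfl⟩
      rw [LinearMap.comp_apply, arcSum_apply, ← h d _ (Or.inl rfl)]
      exact CharTwo.add_self_eq_zero _
  have hinj : Function.Injective p :=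
    LinearMap.funLeft_injective_of_surjective _ _ _ Quot.mk_surjective
  have h1 := LinearMap.finrank_range_add_finrank_ker (arcSum D.arc ∘ₗ p)
  have := Fintype.ofFinite (Face D.arc)
  rw [(Submodule.equivMapOfInjective _ hinj _).finrank_eq, hker, finrank_range_funLeft_quot,
    Module.finrank_fintype_fun_eq_card, ← Nat.card_eq_fintype_card] at h1
  exact h1

/-- A planar diagram has a checkerboard colouring. The value at a dart is the colour of the face to
one side of it. By Euler's formula, the cellular cochain complex of the dual cell structure is exact
at the arcs; as every crossing has four ends, the function with the value `1` on each arc is a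
cocycle, hence a coboundary of a function on the faces. -/
theorem exists_checkerboard (D : LinkDiagram) :
    ∃ h : Dart D.n → Bool, (∀ d, h (D.arc d) = !h d) ∧ ∀ d, h (rot d) = !h d := by
  classical
  set p := LinearMap.funLeft (ZMod 2) (ZMod 2)
      (Quot.mk fun d d' : Dart D.n => d' = rot (D.arc d)) with hp
  have hrot : ∀ φ d, p φ (rot (D.arc d)) = p φ d := fun φ d =>
    (mem_range_funLeft_quot.1 ⟨φ, rfl⟩ d _ rfl).symm
  have hle : LinearMap.range (arcSum D.arc ∘ₗ p) ≤
      LinearMap.range (arcSum D.arc) ⊓ LinearMap.ker crossingSum := by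
    rintro _ ⟨φ, rfl⟩
    refine ⟨⟨p φ, rfl⟩, LinearMap.mem_ker.2 (funext fun c => ?_)⟩
    have h : ∀ i, arcSum D.arc (p φ) (c, i) = p φ (c, i) + p φ (c, i + 1) := by
      intro i
      rw [arcSum_apply, ← hrot φ (D.arc (c, i)), D.arc_arc]
      rfl
    rw [LinearMap.comp_apply, crossingSum_apply, Finset.sum_congr rfl fun i _ => h i,
      Finset.sum_add_distrib]
    have := Equiv.sum_comp (Equiv.addRight (1 : Fin 4)) fun i => p φ (c, i)
    rw [Equiv.coe_addRight] at this
    rw [this]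
    exact CharTwo.add_self_eq_zero _
  have heq : LinearMap.range (arcSum D.arc ∘ₗ p) =
      LinearMap.range (arcSum D.arc) ⊓ LinearMap.ker crossingSum := by
    refine Submodule.eq_of_le_of_finrank_eq hle ?_
    have h1 := LinearMap.finrank_range_add_finrank_ker
      ((crossingSum (n := D.n)).domRestrict (LinearMap.range (arcSum D.arc)))
    rw [LinearMap.range_domRestrict, ← LinearMap.range_comp, finrank_range_arcSum,
      (Submodule.equivMapOfInjective _ (Submodule.injective_subtype _) _).finrank_eq,
      LinearMap.ker_domRestrict, Submodule.map_comap_subtype] at h1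
    have h2 := finrank_range_crossingSum_arcSum D
    have h3 := finrank_range_arcSum_face D
    have h4 := D.planar
    rw [← hp] at h3
    omega
  have hone : (fun _ => 1 : Dart D.n → ZMod 2) ∈
      LinearMap.range (arcSum D.arc) ⊓ LinearMap.ker crossingSum := by
    refine ⟨⟨fun d => if IsOut D.positive d then 1 else 0, funext fun d => isOut_ite_add D d⟩, ?_⟩
    refine LinearMap.mem_ker.2 (funext fun c => ?_)
    simp only [crossingSum_apply, Finset.sum_const, Finset.card_univ, Fintype.card_fin]
    rfl
  rw [← heq] at hone
  obtain ⟨φ, hφ⟩ := hone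
  have harc : ∀ d, p φ (D.arc d) = p φ d + 1 := by
    intro d
    have h := congrFun hφ d
    rw [LinearMap.comp_apply, arcSum_apply] at h
    rw [← h, ← add_assoc, CharTwo.add_self_eq_zero, zero_add]
  have hbool : ∀ a : ZMod 2, decide (a + 1 = 1) = !decide (a = 1) := by decide
  refine ⟨fun d => decide (p φ d = 1), fun d => ?_, fun d => ?_⟩
  · simp only [harc, hbool]
  · have h := hrot φ (D.arc d)
    rw [D.arc_arc] at h
    simp only [h, harc, hbool]

end Checkerboard

end LinkDiagram

/-! ### Merging and splitting circles -/

section SwapCycles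

variable {α : Type*} [Finite α]

theorem not_sameCycle_of_pow_apply_eq_self {f : Equiv.Perm α} {x y : α} {n : ℕ} (hn : 0 < n)
    (hx : (f ^ n) x = x) (hy : ∀ k < n, (f ^ k) x ≠ y) : ¬ f.SameCycle x y := by
  intro h
  obtain ⟨m, hm⟩ := h.exists_nat_pow_eq
  refine hy (m % n) (Nat.mod_lt _ hn) ?_
  rw [← hm]
  conv_rhs => rw [← Nat.mod_add_div m n, pow_add, Equiv.Perm.mul_apply, pow_mul,
    Equiv.Perm.pow_apply_eq_self_of_apply_eq_self hx]

/-- Composing a permutation with the transposition of two points either cuts their common cycle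
into two or joins their two cycles. -/
theorem Equiv.Perm.sameCycle_swap_mul_iff [DecidableEq α] (f : Equiv.Perm α) {x y : α}
    (hxy : x ≠ y) : (Equiv.swap x y * f).SameCycle x y ↔ ¬ f.SameCycle x y := by
  classical
  have hex : ∃ n, 0 < n ∧ ((f ^ n) x = x ∨ (f ^ n) x = y) :=
    ⟨orderOf f, orderOf_pos f, Or.inl (by rw [pow_orderOf_eq_one]; rfl)⟩
  set n := Nat.find hex
  -- `n` is the time of the first return of `x` to `{x, y}`.
  obtain ⟨hn, hret⟩ : 0 < n ∧ ((f ^ n) x = x ∨ (f ^ n) x = y) := Nat.find_spec hex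
  have hmin : ∀ k < n, 0 < k → (f ^ k) x ≠ x ∧ (f ^ k) x ≠ y := fun k hk h0 =>
    not_or.1 fun h => Nat.find_min hex hk ⟨h0, h⟩
  have hne : ∀ k < n, (f ^ k) x ≠ y := by
    intro k hk
    rcases Nat.eq_zero_or_pos k with rfl | h0
    · exact hxy
    · exact (hmin k hk h0).2
  set g := Equiv.swap x y * f with hg
  have hpow : ∀ k < n, (g ^ k) x = (f ^ k) x := by
    intro k
    induction k with
    | zero => intro; rfl
    | succ k ih =>
      intro hk
      rw [pow_succ', Equiv.Perm.mul_apply, ih (by omega), hg, Equiv.Perm.mul_apply,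
        ← Equiv.Perm.mul_apply f, ← pow_succ']
      exact Equiv.swap_apply_of_ne_of_ne (hmin _ hk k.succ_pos).1 (hmin _ hk k.succ_pos).2
  have hlast : (g ^ n) x = Equiv.swap x y ((f ^ n) x) := by
    obtain ⟨k, hk⟩ : ∃ k, n = k + 1 := ⟨n - 1, by omega⟩
    rw [hk, pow_succ', Equiv.Perm.mul_apply, hpow k (by omega), hg, Equiv.Perm.mul_apply,
      ← Equiv.Perm.mul_apply f, ← pow_succ']
  rcases hret with h | h
  · rw [h, Equiv.swap_apply_left] at hlast
    exact iff_of_true ⟨n, by simpa using hlast⟩ (not_sameCycle_of_pow_apply_eq_self hn h hne)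
  · rw [h, Equiv.swap_apply_right] at hlast
    refine iff_of_false (not_sameCycle_of_pow_apply_eq_self hn hlast fun k hk => ?_)
      (not_not.2 ⟨n, by simpa using h⟩)
    rw [hpow k hk]
    exact hne k hk

end SwapCycles

namespace LinkDiagram

variable {D : LinkDiagram}

theorem circleOf_arc (s : D.Vertex) (d : Dart D.n) : circleOf s (D.arc d) = circleOf s d :=
  congrArg Sum.inl
    (Quot.sound (r := fun d d' => d' = D.arc d ∨ d' = smooth s d) (Or.inl rfl)).symm

theorem circleOf_smooth (s : D.Vertex) (d : Dart D.n) :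
    circleOf s (smooth s d) = circleOf s d :=
  congrArg Sum.inl
    (Quot.sound (r := fun d d' => d' = D.arc d ∨ d' = smooth s d) (Or.inr rfl)).symm

/-- Induction over the darts of a circle. -/
theorem rel_of_circleOf_eq {s : D.Vertex} {r : Dart D.n → Dart D.n → Prop} (hr : Equivalence r)
    (harc : ∀ d, r d (D.arc d)) (hsm : ∀ d, r d (smooth s d)) {d d' : Dart D.n}
    (h : circleOf s d = circleOf s d') : r d d' := by
  have h1 := Quot.eqvGen_exact (Sum.inl_injective h)
  rw [← hr.eqvGen_iff]
  refine Relation.EqvGen.mono ?_ _ _ h1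
  rintro a b (rfl | rfl)
  · exact harc a
  · exact hsm a

theorem exists_circleOf_eq_or_inr (s : D.Vertex) (a : Circle s) :
    (∃ d, a = circleOf s d) ∨ ∃ k, a = Sum.inr k := by
  rcases a with a | k
  · obtain ⟨d, rfl⟩ := Quot.exists_rep a
    exact Or.inl ⟨d, rfl⟩
  · exact Or.inr ⟨k, rfl⟩

theorem circleOf_ne_inr (s : D.Vertex) (d : Dart D.n) (k : Fin D.loops) :
    circleOf s d ≠ Sum.inr k := Sum.inl_ne_inr

theorem smooth_smooth (s : D.Vertex) (d : Dart D.n) : smooth s (smooth s d) = d := by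
  obtain ⟨c, i⟩ := d
  simp only [smooth]
  split_ifs <;> simp

theorem smooth_false {s : D.Vertex} {c : Fin D.n} (h : s c = false) (i : Fin 4) :
    smooth s (c, i) = (c, 1 - i) := by simp [smooth, h]

theorem smooth_true {s : D.Vertex} {c : Fin D.n} (h : s c = true) (i : Fin 4) :
    smooth s (c, i) = (c, 3 - i) := by simp [smooth, h]

theorem opp_opp {n : ℕ} (d : Dart n) : opp (opp d) = d := by
  obtain ⟨c, i⟩ := d
  simp only [opp, Prod.mk.injEq, true_and]
  revert i; decide

theorem circleOf_crossing_false {s : D.Vertex} {c : Fin D.n} (h : s c = false) :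
    circleOf s (c, 1) = circleOf s (c, 0) ∧ circleOf s (c, 3) = circleOf s (c, 2) := by
  have h0 := circleOf_smooth s (c, 0)
  have h2 := circleOf_smooth s (c, 2)
  rw [smooth_false h] at h0 h2
  exact ⟨h0, h2⟩

theorem circleOf_crossing_true {s : D.Vertex} {c : Fin D.n} (h : s c = true) :
    circleOf s (c, 3) = circleOf s (c, 0) ∧ circleOf s (c, 1) = circleOf s (c, 2) := by
  have h0 := circleOf_smooth s (c, 0)
  have h2 := circleOf_smooth s (c, 2)
  rw [smooth_true h] at h0 h2
  exact ⟨h0, h2⟩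

theorem circleOf_crossing (s : D.Vertex) (c : Fin D.n) (i : Fin 4) :
    circleOf s (c, i) = circleOf s (c, 0) ∨ circleOf s (c, i) = circleOf s (c, 2) := by
  cases h : s c
  · obtain ⟨h1, h2⟩ := circleOf_crossing_false h
    fin_cases i
    exacts [Or.inl rfl, Or.inl h1, Or.inr rfl, Or.inr h2]
  · obtain ⟨h1, h2⟩ := circleOf_crossing_true h
    fin_cases i
    exacts [Or.inl rfl, Or.inr h2, Or.inr rfl, Or.inl h1]

theorem smooth_congr {s s' : D.Vertex} {d : Dart D.n} (h : s d.1 = s' d.1) :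
    smooth s d = smooth s' d := by
  simp only [smooth, h]

/-- If one circle of `s'` contains both strands at `c`, then each circle of `s` is contained in a
circle of `s'`. -/
theorem circleOf_eq_of_circleOf_eq {s s' : D.Vertex} {c : Fin D.n} (hs : ∀ j ≠ c, s j = s' j)
    (h : circleOf s' (c, 0) = circleOf s' (c, 2)) {d d' : Dart D.n}
    (hd : circleOf s d = circleOf s d') : circleOf s' d = circleOf s' d' := by
  refine rel_of_circleOf_eq (r := fun d d' => circleOf s' d = circleOf s' d')
    ⟨fun _ => rfl, Eq.symm, Eq.trans⟩ (fun d => (circleOf_arc s' d).symm) (fun d => ?_) hd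
  by_cases hc : d.1 = c
  · have hall : ∀ i, circleOf s' (c, i) = circleOf s' (c, 0) := fun i =>
      (circleOf_crossing s' c i).elim id fun h1 => h1.trans h.symm
    obtain ⟨c', i⟩ := d
    obtain rfl : c' = c := hc
    exact (hall i).trans (hall _).symm
  · rw [smooth_congr (hs _ hc), circleOf_smooth]

/-- Two darts on one circle of `s'` lie on one circle of `s`, or else both of them lie on circles of
`s` through `c`. -/
theorem circleOf_eq_or_of_circleOf_eq {s s' : D.Vertex} {c : Fin D.n} (hs : ∀ j ≠ c, s j = s' j)
    {d d' : Dart D.n} (hd : circleOf s' d = circleOf s' d') :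
    circleOf s d = circleOf s d' ∨
      ((circleOf s d = circleOf s (c, 0) ∨ circleOf s d = circleOf s (c, 2)) ∧
        (circleOf s d' = circleOf s (c, 0) ∨ circleOf s d' = circleOf s (c, 2))) := by
  refine rel_of_circleOf_eq (r := fun d d' => circleOf s d = circleOf s d' ∨
      ((circleOf s d = circleOf s (c, 0) ∨ circleOf s d = circleOf s (c, 2)) ∧
        (circleOf s d' = circleOf s (c, 0) ∨ circleOf s d' = circleOf s (c, 2))))
    ⟨fun _ => Or.inl rfl, ?_, ?_⟩ (fun d => Or.inl (circleOf_arc s d).symm) (fun d => ?_) hd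
  · rintro x y (h | ⟨h1, h2⟩)
    · exact Or.inl h.symm
    · exact Or.inr ⟨h2, h1⟩
  · rintro x y z (h | ⟨h1, h2⟩) (h' | ⟨h1', h2'⟩)
    · exact Or.inl (h.trans h')
    · exact Or.inr ⟨by rwa [h], h2'⟩
    · exact Or.inr ⟨h1, by rwa [← h']⟩
    · exact Or.inr ⟨h1, h2'⟩
  · by_cases hc : d.1 = c
    · obtain ⟨c', i⟩ := d
      obtain rfl : c' = c := hc
      exact Or.inr ⟨circleOf_crossing s _ i, circleOf_crossing s _ _⟩
    · exact Or.inl (by rw [← smooth_congr (hs _ hc), circleOf_smooth])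

section Toggle

variable {h : Dart D.n → Bool} (harc : ∀ d, h (D.arc d) = !h d) (hrot : ∀ d, h (rot d) = !h d)

include hrot in
theorem checkerboard_smooth (s : D.Vertex) (d : Dart D.n) : h (smooth s d) = !h d := by
  obtain ⟨c, i⟩ := d
  have h0 := hrot (c, 0)
  have h1 := hrot (c, 1)
  have h2 := hrot (c, 2)
  have h3 := hrot (c, 3)
  have e1 : (1 + 1 : Fin 4) = 2 := rfl
  have e2 : (2 + 1 : Fin 4) = 3 := rfl
  have e3 : (3 + 1 : Fin 4) = 0 := rfl
  simp only [rot, zero_add, e1, e2, e3] at h0 h1 h2 h3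
  cases hs : s c
  · rw [smooth_false hs]
    fin_cases i
    · exact h0
    · change h (c, 0) = _
      simp [h0]
    · exact h2
    · change h (c, 2) = _
      simp [h2]
  · rw [smooth_true hs]
    fin_cases i
    · change h (c, 3) = _
      simp [h3]
    · exact h1
    · change h (c, 1) = _
      simp [h1]
    · exact h3

include hrot in
theorem checkerboard_opp (d : Dart D.n) : h (opp d) = h d := by
  have : opp d = rot (rot d) := by
    obtain ⟨c, i⟩ := d
    simp only [opp, rot, add_assoc]
    rfl
  rw [this, hrot, hrot, Bool.not_not]

/-- The checkerboard colouring orients every circle of a smoothing; this permutation of the darts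
at which the orientation leaves a crossing follows the circles. -/
def followCircle (s : D.Vertex) : Equiv.Perm {d : Dart D.n // h d = true} where
  toFun d := ⟨smooth s (D.arc d), by rw [checkerboard_smooth hrot, harc, d.2]; rfl⟩
  invFun d := ⟨D.arc (smooth s d), by rw [harc, checkerboard_smooth hrot, d.2]; rfl⟩
  left_inv d := Subtype.ext (by simp only [smooth_smooth, D.arc_arc])
  right_inv d := Subtype.ext (by simp only [smooth_smooth, D.arc_arc])

theorem sameCycle_followCircle_iff (s : D.Vertex) (x y : {d : Dart D.n // h d = true}) :
    (followCircle harc hrot s).SameCycle x y ↔ circleOf s x = circleOf s y := by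
  set f := followCircle harc hrot s with hf
  constructor
  · intro hxy
    obtain ⟨k, rfl⟩ := hxy.exists_nat_pow_eq
    clear hxy
    induction k with
    | zero => rfl
    | succ k ih =>
      rw [ih, pow_succ', Equiv.Perm.mul_apply]
      exact ((circleOf_smooth s _).trans (circleOf_arc s _)).symm
  · intro hxy
    -- The dart of the same arc at which the orientation leaves a crossing.
    let out : Dart D.n → {d : Dart D.n // h d = true} := fun d =>
      if hd : h d = true then ⟨d, hd⟩ else ⟨D.arc d, by simp [harc, hd]⟩
    have hout : ∀ x : {d : Dart D.n // h d = true}, out x = x := fun x => dif_pos x.2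
    rw [← hout x, ← hout y]
    refine rel_of_circleOf_eq (r := fun d d' => f.SameCycle (out d) (out d'))
      ⟨fun _ => Equiv.Perm.SameCycle.rfl, Equiv.Perm.SameCycle.symm, Equiv.Perm.SameCycle.trans⟩
      (fun d => ?_) (fun d => ?_) hxy
    · have : out d = out (D.arc d) := by
        apply Subtype.ext
        by_cases hd : h d = true <;> simp [out, hd, harc, D.arc_arc]
      rw [this]
    · by_cases hd : h d = true
      · have : out d = f (out (smooth s d)) := by
          apply Subtype.ext
          simp [out, hd, checkerboard_smooth hrot, hf, followCircle, D.arc_arc, smooth_smooth]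
        rw [this]
        exact Equiv.Perm.sameCycle_apply_left.2 Equiv.Perm.SameCycle.rfl
      · have : out (smooth s d) = f (out d) := by
          apply Subtype.ext
          simp [out, hd, checkerboard_smooth hrot, hf, followCircle, D.arc_arc]
        rw [this]
        exact Equiv.Perm.sameCycle_apply_right.2 Equiv.Perm.SameCycle.rfl

end Toggle

theorem smooth_update (s : D.Vertex) {c : Fin D.n} (hc : s c = false) (i : Fin 4) :
    smooth (Function.update s c true) (c, i) = opp (smooth s (c, i)) := by
  rw [smooth_true (Function.update_self c true s), smooth_false hc]
  simp only [opp, Prod.mk.injEq, true_and]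
  revert i; decide

/-- In a planar diagram, changing the smoothing of one crossing either merges two circles or splits
one. -/
theorem circleOf_update_eq_iff (s : D.Vertex) {c : Fin D.n} (hc : s c = false) :
    circleOf (Function.update s c true) (c, 0) = circleOf (Function.update s c true) (c, 2) ↔
      circleOf s (c, 0) ≠ circleOf s (c, 2) := by
  classical
  obtain ⟨h, harc, hrot⟩ := exists_checkerboard D
  set s' := Function.update s c true with hs'
  have hc' : s' c = true := Function.update_self c true s
  have hrot0 : h (c, 1) = !h (c, 0) := hrot (c, 0)
  have hopp := fun d => checkerboard_opp hrot d
  -- The two darts at `c` where the orientation of the circles leaves `c` are exchanged.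
  obtain ⟨i, hi01, hi⟩ : ∃ i : Fin 4, (i = 0 ∨ i = 1) ∧ h (c, i) = true := by
    cases h0 : h (c, 0)
    · exact ⟨1, Or.inr rfl, by simp [hrot0, h0]⟩
    · exact ⟨0, Or.inl rfl, h0⟩
  let x : {d : Dart D.n // h d = true} := ⟨(c, i), hi⟩
  let y : {d : Dart D.n // h d = true} := ⟨opp (c, i), by rw [hopp, hi]⟩
  have hxy : x ≠ y := by
    intro hxy
    have := congrArg (fun z => z.1.2) hxy
    simp only [x, y, opp] at this
    revert this
    clear * -
    revert i; decide
  have hcross : ∀ z : {d : Dart D.n // h d = true}, z.1.1 = c → z = x ∨ z = y := by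
    rintro ⟨⟨c', j⟩, hj⟩ rfl
    simp only [x, y, Subtype.mk.injEq, opp, Prod.mk.injEq, true_and]
    by_contra hcon
    have : (c', j) = rot (c', i) ∨ (c', j) = opp (rot (c', i)) := by
      simp only [rot, opp, Prod.mk.injEq, true_and]
      clear * - hcon
      revert i j; decide
    rcases this with h1 | h1
    · rw [h1, hrot, hi] at hj
      exact absurd hj (by decide)
    · rw [h1, hopp, hrot, hi] at hj
      exact absurd hj (by decide)
  have hperm : followCircle harc hrot s' = Equiv.swap x y * followCircle harc hrot s := by
    ext1 d
    rw [Equiv.Perm.mul_apply]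
    by_cases hd : (D.arc d).1 = c
    · have h1 : (followCircle harc hrot s' d).1 = opp (followCircle harc hrot s d).1 := by
        obtain ⟨j, hj⟩ : ∃ j, D.arc d = (c, j) := ⟨(D.arc d).2, by rw [← hd]⟩
        change smooth s' (D.arc d) = opp (smooth s (D.arc d))
        rw [hj]
        exact smooth_update s hc j
      rcases hcross (followCircle harc hrot s d) hd with h2 | h2
      · rw [h2, Equiv.swap_apply_left]
        exact Subtype.ext (by rw [h1, h2])
      · rw [h2, Equiv.swap_apply_right]
        exact Subtype.ext (by rw [h1, h2]; exact opp_opp _)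
    · rw [Equiv.swap_apply_of_ne_of_ne]
      · exact Subtype.ext (smooth_congr (Function.update_of_ne hd _ _))
      · intro h1
        exact hd (congrArg (fun z => z.1.1) h1)
      · intro h1
        exact hd (congrArg (fun z => z.1.1) h1)
  have key := Equiv.Perm.sameCycle_swap_mul_iff (followCircle harc hrot s) hxy
  rw [← hperm, sameCycle_followCircle_iff, sameCycle_followCircle_iff] at key
  obtain ⟨e1, e2⟩ := circleOf_crossing_false hc
  obtain ⟨e3, e4⟩ := circleOf_crossing_true hc'
  rcases hi01 with rfl | rfl
  · exact key
  · have ho : opp (c, (1 : Fin 4)) = (c, 3) := rfl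
    simp only [x, y, ho, e1, e2, e3, e4] at key
    rw [eq_comm]
    exact key

end LinkDiagram

/-! ### Diagonalizing the Frobenius algebra -/

namespace LinkDiagram

/-- A basis of `A` over a field in which multiplication and comultiplication are diagonal. The row
`P a` holds the coordinates at `1` and `X` of the linear form dual to the basis vector `a`; the
basis is scaled so that the multiplication and the comultiplication have the same eigenvalue `σ a`
at `a`. -/
structure DiagonalBasis {K : Type} [Field K] (t : K) where
  /-- the dual basis -/
  P : Matrix Bool Bool K
  /-- the common eigenvalues of multiplication and comultiplication -/
  σ : Bool → K
  σ_ne_zero : ∀ a, σ a ≠ 0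
  /-- the basis vectors -/
  inv : Matrix Bool Bool K
  mul_inv : P * inv = 1
  mul : ∀ a x y, ∑ b, P a b * mulCoeff t x y b = σ a * (P a x * P a y)
  comul : ∀ a a' x, ∑ b : Bool × Bool, P a b.1 * P a' b.2 * comulCoeff t x b.1 b.2 =
    if a = a' then σ a * P a x else 0

/-- For `t = r ^ 2 ≠ 0` the dual basis consists of the evaluations at the roots `r` and `-r` of
`X ^ 2 = t`. Unscaled, these have the eigenvalue `1` for multiplication and `± 2 * r` for
comultiplication; dividing by a square root of `± 2 * r` makes them equal. -/
theorem nonempty_diagonalBasis {K : Type} [Field K] [IsAlgClosed K] [CharZero K] {t : K}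
    (ht : t ≠ 0) : Nonempty (DiagonalBasis t) := by
  obtain ⟨r, hr⟩ := IsAlgClosed.exists_pow_nat_eq t (n := 2) (by norm_num)
  obtain ⟨u, hu⟩ := IsAlgClosed.exists_pow_nat_eq (2 * r) (n := 2) (by norm_num)
  obtain ⟨v, hv⟩ := IsAlgClosed.exists_pow_nat_eq (-(2 * r)) (n := 2) (by norm_num)
  have hr0 : r ≠ 0 := by
    rintro rfl
    exact ht (by rw [← hr]; simp)
  have hu0 : u ≠ 0 := by
    rintro rfl
    refine hr0 ?_
    simpa using hu.symm
  have hv0 : v ≠ 0 := by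
    rintro rfl
    refine hr0 ?_
    simpa using hv.symm
  refine ⟨⟨Matrix.of fun a b => bif a then (bif b then u⁻¹ * r else u⁻¹)
      else (bif b then -(v⁻¹ * r) else v⁻¹), fun a => bif a then u else v, ?_,
    Matrix.of fun b a => bif a then (bif b then u / (2 * r) else u / 2)
      else (bif b then -(v / (2 * r)) else v / 2), ?_, ?_, ?_⟩⟩
  · intro a
    cases a
    · exact hv0
    · exact hu0
  · ext a a'
    rw [Matrix.mul_apply, Fintype.sum_bool]
    cases a <;> cases a' <;> simp <;> field_simp <;> ring
  · intro a x y
    rw [Fintype.sum_bool]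
    cases a <;> cases x <;> cases y <;> simp [mulCoeff, ← hr] <;> field_simp
  · intro a a' x
    rw [Fintype.sum_prod_type, Fintype.sum_bool, Fintype.sum_bool, Fintype.sum_bool]
    cases a <;> cases a' <;> cases x <;> simp [comulCoeff, ← hr] <;> field_simp
    all_goals first | (rw [hu]; ring) | (rw [hv]; ring) | ring

/-! ### Tensor powers -/

section TensorPower

variable {K : Type} [Field K] {A B : Type} [Fintype A] [Fintype B] [DecidableEq A] [DecidableEq B]

/-- The tensor power of a matrix over an index set `A`. -/
def tensorPower (A : Type) [Fintype A] (P : Matrix Bool Bool K) :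
    Matrix (A → Bool) (A → Bool) K :=
  Matrix.of fun f x => ∏ a, P (f a) (x a)

theorem tensorPower_mul (P Q : Matrix Bool Bool K) :
    tensorPower A P * tensorPower A Q = tensorPower A (P * Q) := by
  ext f x
  simp only [tensorPower, Matrix.mul_apply, Matrix.of_apply, ← Finset.prod_mul_distrib]
  rw [Finset.prod_univ_sum, Fintype.piFinset_univ]

omit [DecidableEq A] in
theorem tensorPower_one : tensorPower A (1 : Matrix Bool Bool K) = 1 := by
  ext f x
  simp only [tensorPower, Matrix.of_apply]
  by_cases h : f = x
  · rw [h, Matrix.one_apply_eq]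
    exact Finset.prod_eq_one fun a _ => Matrix.one_apply_eq _
  · rw [Matrix.one_apply_ne h]
    obtain ⟨a, ha⟩ := Function.ne_iff.1 h
    exact Finset.prod_eq_zero (Finset.mem_univ a) (Matrix.one_apply_ne ha)

/-- The map `q` identifies the two points `a₀` and `a₂` and nothing else. -/
structure IsMerge (q : A → B) (a₀ a₂ : A) : Prop where
  surjective : Function.Surjective q
  ne : a₀ ≠ a₂
  map_eq : q a₀ = q a₂
  eq_or : ∀ a a', q a = q a' → a = a' ∨ ((a = a₀ ∨ a = a₂) ∧ (a' = a₀ ∨ a' = a₂))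

namespace IsMerge

variable {q : A → B} {a₀ a₂ : A}

omit [Fintype A] [Fintype B] [DecidableEq A] [DecidableEq B] in
theorem map_ne (hq : IsMerge q a₀ a₂) {a : A} (h0 : a ≠ a₀) (h2 : a ≠ a₂) : q a ≠ q a₀ := by
  intro h
  rcases hq.eq_or _ _ h with h | ⟨h | h, -⟩
  exacts [h0 h, h0 h, h2 h]

omit [Fintype B] [DecidableEq B] in
theorem prod_left (hq : IsMerge q a₀ a₂) (F : A → K) :
    ∏ a, F a = F a₀ * F a₂ * ∏ a ∈ (Finset.univ.erase a₀).erase a₂, F a := by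
  rw [mul_assoc, Finset.mul_prod_erase _ _ (by simp [hq.ne.symm]),
    Finset.mul_prod_erase _ _ (Finset.mem_univ _)]

theorem prod_right (hq : IsMerge q a₀ a₂) (F : B → K) :
    ∏ b, F b = F (q a₀) * ∏ a ∈ (Finset.univ.erase a₀).erase a₂, F (q a) := by
  rw [← Finset.mul_prod_erase _ _ (Finset.mem_univ (q a₀))]
  congr 1
  refine (Finset.prod_nbij q ?_ ?_ ?_ fun _ _ => rfl).symm
  · intro a ha
    simp only [Finset.mem_erase, Finset.mem_univ, and_true] at ha ⊢
    exact hq.map_ne ha.2 ha.1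
  · intro a ha a' ha' h
    simp only [Finset.coe_erase, Finset.coe_univ, Set.mem_sdiff, Set.mem_univ, true_and,
      Set.mem_singleton_iff] at ha ha'
    rcases hq.eq_or _ _ h with h | ⟨h | h, -⟩
    exacts [h, absurd h ha.1, absurd h ha.2]
  · intro b hb
    simp only [Finset.coe_erase, Finset.coe_univ, Set.mem_sdiff, Set.mem_univ, true_and,
      Set.mem_singleton_iff] at hb
    obtain ⟨a, rfl⟩ := hq.surjective b
    refine ⟨a, ?_, rfl⟩
    simp only [Finset.coe_erase, Finset.coe_univ, Set.mem_sdiff, Set.mem_univ, true_and,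
      Set.mem_singleton_iff]
    exact ⟨fun h => hb (by rw [h]), fun h => hb (by rw [h, hq.map_eq])⟩

/-- The multiplication in the diagonal basis. -/
theorem sum_mulCoeff (hq : IsMerge q a₀ a₂) {t : K} (S : DiagonalBasis t) (x : A → Bool)
    (g : B → Bool) :
    ∑ y : B → Bool, (∏ b, S.P (g b) (y b)) *
      (if ∀ a, a ≠ a₀ → a ≠ a₂ → y (q a) = x a then mulCoeff t (x a₀) (x a₂) (y (q a₀)) else 0) =
      S.σ (g (q a₀)) * ∏ a, S.P (g (q a)) (x a) := by
  let e : Bool → B → Bool := fun β b =>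
    if b = q a₀ then β else x (Function.surjInv hq.surjective b)
  have he0 : ∀ β, e β (q a₀) = β := fun β => if_pos rfl
  have he : ∀ β a, a ≠ a₀ → a ≠ a₂ → e β (q a) = x a := by
    intro β a h0 h2
    have h := Function.surjInv_eq hq.surjective (q a)
    simp only [e, if_neg (hq.map_ne h0 h2)]
    rcases hq.eq_or _ _ h with h | ⟨-, h | h⟩
    exacts [by rw [h], absurd h h0, absurd h h2]
  rw [← Fintype.sum_of_injective e (fun β β' h => by rw [← he0 β, h, he0])
    (fun β => (S.P (g (q a₀)) β * mulCoeff t (x a₀) (x a₂) β) *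
      ∏ a ∈ (Finset.univ.erase a₀).erase a₂, S.P (g (q a)) (x a)) _ ?_ ?_]
  · rw [← Finset.sum_mul, S.mul, hq.prod_left, ← hq.map_eq]
    ring
  · intro y hy
    rw [if_neg, mul_zero]
    intro h
    refine hy ⟨y (q a₀), funext fun b => ?_⟩
    obtain ⟨a, rfl⟩ := hq.surjective b
    by_cases h0 : a = a₀
    · rw [h0, he0]
    by_cases h2 : a = a₂
    · rw [h2, ← hq.map_eq, he0]
    rw [he _ _ h0 h2, h a h0 h2]
  · intro β
    rw [if_pos (he β), hq.prod_right, he0]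
    have : ∀ a ∈ (Finset.univ.erase a₀).erase a₂, S.P (g (q a)) (e β (q a)) =
        S.P (g (q a)) (x a) := by
      intro a ha
      simp only [Finset.mem_erase, Finset.mem_univ, and_true] at ha
      rw [he β a ha.2 ha.1]
    rw [Finset.prod_congr rfl this]
    ring

omit [Fintype B] [DecidableEq B] in
/-- The comultiplication in the diagonal basis. -/
theorem sum_comulCoeff (hq : IsMerge q a₀ a₂) {t : K} (S : DiagonalBasis t) (x : B → Bool)
    (g : A → Bool) :
    ∑ y : A → Bool, (∏ a, S.P (g a) (y a)) *
      (if ∀ a, a ≠ a₀ → a ≠ a₂ → y a = x (q a) then comulCoeff t (x (q a₀)) (y a₀) (y a₂) else 0) =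
      (if g a₀ = g a₂ then S.σ (g a₀) * S.P (g a₀) (x (q a₀)) else 0) *
        ∏ a ∈ (Finset.univ.erase a₀).erase a₂, S.P (g a) (x (q a)) := by
  let e : Bool × Bool → A → Bool := fun β a =>
    if a = a₀ then β.1 else if a = a₂ then β.2 else x (q a)
  have he0 : ∀ β, e β a₀ = β.1 := fun β => if_pos rfl
  have he2 : ∀ β, e β a₂ = β.2 := fun β => by simp [e, hq.ne.symm]
  have he : ∀ β a, a ≠ a₀ → a ≠ a₂ → e β a = x (q a) := by
    intro β a h0 h2
    simp only [e, if_neg h0, if_neg h2]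
  rw [← S.comul, Finset.sum_mul]
  refine (Fintype.sum_of_injective e
    (fun β β' h => Prod.ext (by rw [← he0 β, h, he0]) (by rw [← he2 β, h, he2])) _ _ ?_ ?_).symm
  · intro y hy
    rw [if_neg, mul_zero]
    intro h
    refine hy ⟨(y a₀, y a₂), funext fun a => ?_⟩
    by_cases h0 : a = a₀
    · rw [h0, he0]
    by_cases h2 : a = a₂
    · rw [h2, he2]
    rw [he _ _ h0 h2, h a h0 h2]
  · intro β
    rw [if_pos (he β), hq.prod_left, he0, he2]
    have : ∀ a ∈ (Finset.univ.erase a₀).erase a₂, S.P (g a) (e β a) = S.P (g a) (x (q a)) := by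
      intro a ha
      simp only [Finset.mem_erase, Finset.mem_univ, and_true] at ha
      rw [he β a ha.2 ha.1]
    rw [Finset.prod_congr rfl this]
    ring

end IsMerge

end TensorPower

end LinkDiagram

/-! ### The complex in the diagonal basis -/

namespace LinkDiagram

variable {D : LinkDiagram}

/-- The label of the circle through the dart `d`. -/
def colour (x : D.EnhancedState) (d : Dart D.n) : Bool := x.2 (circleOf x.1 d)

/-- The labels of the circles without crossings. -/
def loopColour (x : D.EnhancedState) (k : Fin D.loops) : Bool := x.2 (Sum.inr k)

theorem colour_arc (x : D.EnhancedState) (d : Dart D.n) : colour x (D.arc d) = colour x d :=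
  congrArg x.2 (circleOf_arc x.1 d)

theorem colour_smooth (x : D.EnhancedState) (d : Dart D.n) :
    colour x (smooth x.1 d) = colour x d :=
  congrArg x.2 (circleOf_smooth x.1 d)

theorem enhancedState_ext {x y : D.EnhancedState} (h : x.1 = y.1) (hc : colour x = colour y)
    (hl : loopColour x = loopColour y) : x = y := by
  obtain ⟨s, f⟩ := x
  obtain ⟨s', g⟩ := y
  obtain rfl : s = s' := h
  congr 1
  funext a
  rcases exists_circleOf_eq_or_inr s a with ⟨d, rfl⟩ | ⟨k, rfl⟩
  · exact congrFun hc d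
  · exact congrFun hl k

/-- A colouring of the darts that is constant along the circles of `s` comes from a state. -/
theorem exists_enhancedState (s : D.Vertex) (φ : Dart D.n → Bool) (l : Fin D.loops → Bool)
    (harc : ∀ d, φ (D.arc d) = φ d) (hsm : ∀ d, φ (smooth s d) = φ d) :
    ∃ x : D.EnhancedState, x.1 = s ∧ colour x = φ ∧ loopColour x = l := by
  refine ⟨⟨s, Sum.elim (Quot.lift φ ?_) l⟩, rfl, rfl, rfl⟩
  rintro d _ (rfl | rfl)
  exacts [(harc d).symm, (hsm d).symm]

/-- The crossing `c` is free in the state `x` if the two strands at `c` have the same label. -/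
def IsFree (x : D.EnhancedState) (c : Fin D.n) : Prop := colour x (c, 0) = colour x (c, 2)

theorem isFree_congr {x y : D.EnhancedState} (h : colour x = colour y) (c : Fin D.n) :
    IsFree x c ↔ IsFree y c := by
  rw [IsFree, IsFree, h]

theorem IsFree.colour_eq {x : D.EnhancedState} {c : Fin D.n} (h : IsFree x c) (i : Fin 4) :
    colour x (c, i) = colour x (c, 0) := by
  rcases circleOf_crossing x.1 c i with h1 | h1
  · exact congrArg x.2 h1
  · exact (congrArg x.2 h1).trans h.symm

theorem IsFree.exists_flip {x : D.EnhancedState} {c : Fin D.n} (h : IsFree x c) :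
    ∃ y : D.EnhancedState, y.1 = Function.update x.1 c (!x.1 c) ∧ colour y = colour x ∧
      loopColour y = loopColour x := by
  refine exists_enhancedState _ _ _ (colour_arc x) fun d => ?_
  by_cases hd : d.1 = c
  · obtain ⟨c', i⟩ := d
    obtain rfl : c' = c := hd
    exact (h.colour_eq _).trans (h.colour_eq _).symm
  · rw [smooth_congr (Function.update_of_ne hd _ _), colour_smooth]

open Classical in
/-- Change the smoothing of a free crossing `c` and keep the colours of all darts. -/
noncomputable def flip (c : Fin D.n) (x : D.EnhancedState) : D.EnhancedState :=
  if h : IsFree x c then h.exists_flip.choose else x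

section flip

variable {x : D.EnhancedState} {c : Fin D.n}

theorem flip_fst (h : IsFree x c) : (flip c x).1 = Function.update x.1 c (!x.1 c) := by
  rw [flip, dif_pos h]
  exact h.exists_flip.choose_spec.1

theorem flip_fst_self (h : IsFree x c) : (flip c x).1 c = !x.1 c := by
  rw [flip_fst h, Function.update_self]

theorem flip_fst_of_ne (h : IsFree x c) {j : Fin D.n} (hj : j ≠ c) : (flip c x).1 j = x.1 j := by
  rw [flip_fst h, Function.update_of_ne hj]

theorem colour_flip : colour (flip c x) = colour x := by
  by_cases h : IsFree x c
  · rw [flip, dif_pos h]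
    exact h.exists_flip.choose_spec.2.1
  · rw [flip, dif_neg h]

theorem loopColour_flip : loopColour (flip c x) = loopColour x := by
  by_cases h : IsFree x c
  · rw [flip, dif_pos h]
    exact h.exists_flip.choose_spec.2.2
  · rw [flip, dif_neg h]

theorem isFree_flip {j : Fin D.n} : IsFree (flip c x) j ↔ IsFree x j := isFree_congr colour_flip j

theorem flip_flip (h : IsFree x c) : flip c (flip c x) = x := by
  refine enhancedState_ext ?_ (colour_flip.trans colour_flip)
    (loopColour_flip.trans loopColour_flip)
  rw [flip_fst (isFree_flip.2 h), flip_fst_self h, flip_fst h, Bool.not_not,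
    Function.update_idem, Function.update_eq_self]

theorem flip_comm {c' : Fin D.n} (hcc : c ≠ c') (h : IsFree x c) (h' : IsFree x c') :
    flip c' (flip c x) = flip c (flip c' x) := by
  refine enhancedState_ext ?_ (by simp only [colour_flip]) (by simp only [loopColour_flip])
  rw [flip_fst (isFree_flip.2 h'), flip_fst (isFree_flip.2 h), flip_fst_of_ne h hcc.symm,
    flip_fst_of_ne h' hcc, flip_fst h, flip_fst h', Function.update_comm hcc]

/-- Two states with the same colours whose smoothings differ exactly at `c`: the two strands of both
smoothings at `c` have one colour, so `c` is free. -/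
theorem eq_flip_of_colour_eq {y : D.EnhancedState} (hy : y.1 c = true)
    (hx : x.1 = Function.update y.1 c false) (hcol : colour x = colour y)
    (hloop : loopColour x = loopColour y) : IsFree y c ∧ x = flip c y := by
  have hxc : x.1 c = false := by rw [hx, Function.update_self]
  have h1 : colour x (c, 1) = colour x (c, 0) := congrArg x.2 (circleOf_crossing_false hxc).1
  have h2 : colour y (c, 1) = colour y (c, 2) := congrArg y.2 (circleOf_crossing_true hy).2
  have hfree : IsFree y c := by
    rw [IsFree, ← h2, ← hcol, h1]
  refine ⟨hfree, enhancedState_ext ?_ (hcol.trans colour_flip.symm)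
    (hloop.trans loopColour_flip.symm)⟩
  rw [flip_fst hfree, hy, hx]
  rfl

end flip

/-! ### Signs -/

/-- The sign of the edge of the cube at `s` in direction `c`. -/
noncomputable def edgeSign (R : Type) [CommRing R] (s : D.Vertex) (c : Fin D.n) : R :=
  (-1) ^ Nat.card {j : Fin D.n // j < c ∧ s j = true}

section Signs

variable {R : Type} [CommRing R]

theorem edgeSign_eq_prod (s : D.Vertex) (c : Fin D.n) :
    edgeSign R s c = ∏ j, if j < c ∧ s j = true then -1 else 1 := by
  classical
  rw [edgeSign, Finset.prod_ite, Finset.prod_const, Finset.prod_const_one, mul_one,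
    Nat.card_eq_fintype_card, Fintype.card_subtype]

theorem edgeSign_update (s : D.Vertex) (c j : Fin D.n) :
    edgeSign R (Function.update s c (!s c)) j =
      if c < j then -edgeSign R s j else edgeSign R s j := by
  classical
  rw [edgeSign_eq_prod, edgeSign_eq_prod, ← Finset.mul_prod_erase _ _ (Finset.mem_univ c),
    ← Finset.mul_prod_erase Finset.univ (fun k => if k < j ∧ s k = true then (-1 : R) else 1)
      (Finset.mem_univ c), Function.update_self]
  have : ∀ k ∈ Finset.univ.erase c,
      (if k < j ∧ Function.update s c (!s c) k = true then (-1 : R) else 1) =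
        if k < j ∧ s k = true then -1 else 1 := by
    intro k hk
    rw [Function.update_of_ne (Finset.ne_of_mem_erase hk)]
  rw [Finset.prod_congr rfl this]
  cases s c <;> by_cases h : c < j <;> simp [h]

theorem edgeSign_mul_self (s : D.Vertex) (c : Fin D.n) :
    edgeSign R s c * edgeSign R s c = 1 := by
  rw [edgeSign, ← mul_pow, neg_mul_neg, one_mul, one_pow]

theorem edgeSign_flip {x : D.EnhancedState} {c : Fin D.n} (h : IsFree x c) (j : Fin D.n) :
    edgeSign R (flip c x).1 j = if c < j then -edgeSign R x.1 j else edgeSign R x.1 j := by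
  rw [flip_fst h, edgeSign_update]

end Signs

/-! ### The contracting homotopy -/

section Homotopy

variable {K : Type} [Field K] (σ : Bool → K)

open Classical in
/-- The coefficient of the differential at `x`, coming from the state `flip c x`. -/
noncomputable def diagCoeff (c : Fin D.n) (x : D.EnhancedState) : K :=
  if x.1 c = true ∧ IsFree x c then edgeSign K x.1 c * σ (colour x (c, 0)) else 0

open Classical in
/-- The coefficient of the homotopy at `x`, coming from the state `flip c x`. It is supported on the
first free crossing of `x`. -/
noncomputable def homotopyCoeff (c : Fin D.n) (x : D.EnhancedState) : K :=
  if x.1 c = false ∧ IsFree x c ∧ ∀ j < c, ¬ IsFree x j then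
    edgeSign K x.1 c * (σ (colour x (c, 0)))⁻¹ else 0

theorem diagCoeff_ne_zero {c : Fin D.n} {x : D.EnhancedState} (h : diagCoeff σ c x ≠ 0) :
    x.1 c = true ∧ IsFree x c := by
  by_contra hc
  exact h (if_neg hc)

theorem homotopyCoeff_ne_zero {c : Fin D.n} {x : D.EnhancedState} (h : homotopyCoeff σ c x ≠ 0) :
    x.1 c = false ∧ IsFree x c ∧ ∀ j < c, ¬ IsFree x j := by
  by_contra hc
  exact h (if_neg hc)

theorem diagCoeff_of_not_isFree {c : Fin D.n} {x : D.EnhancedState} (h : ¬ IsFree x c) :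
    diagCoeff σ c x = 0 := if_neg fun hc => h hc.2

theorem homotopyCoeff_of_not_isFree {c : Fin D.n} {x : D.EnhancedState} (h : ¬ IsFree x c) :
    homotopyCoeff σ c x = 0 := if_neg fun hc => h hc.2.1

theorem diagCoeff_of_isFree {c : Fin D.n} {x : D.EnhancedState} (h : IsFree x c) :
    diagCoeff σ c x = if x.1 c = true then edgeSign K x.1 c * σ (colour x (c, 0)) else 0 := by
  unfold diagCoeff
  by_cases hx : x.1 c = true
  · rw [if_pos ⟨hx, h⟩, if_pos hx]
  · rw [if_neg (fun hc => hx hc.1), if_neg hx]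

theorem homotopyCoeff_of_first {c : Fin D.n} {x : D.EnhancedState} (h : IsFree x c)
    (hmin : ∀ j < c, ¬ IsFree x j) : homotopyCoeff σ c x =
      if x.1 c = false then edgeSign K x.1 c * (σ (colour x (c, 0)))⁻¹ else 0 := by
  unfold homotopyCoeff
  by_cases hx : x.1 c = false
  · rw [if_pos ⟨hx, h, hmin⟩, if_pos hx]
  · rw [if_neg (fun hc => hx hc.1), if_neg hx]

/-- The squares of the cube anticommute. -/
theorem diagCoeff_mul_diagCoeff_flip (c c' : Fin D.n) (x : D.EnhancedState) (v : D.EnhancedState → K) :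
    diagCoeff σ c x * (diagCoeff σ c' (flip c x) * v (flip c' (flip c x))) =
      -(diagCoeff σ c' x * (diagCoeff σ c (flip c' x) * v (flip c (flip c' x)))) := by
  by_cases hc : IsFree x c
  swap
  · rw [diagCoeff_of_not_isFree σ hc, diagCoeff_of_not_isFree σ (mt isFree_flip.1 hc)]
    ring
  by_cases hc' : IsFree x c'
  swap
  · rw [diagCoeff_of_not_isFree σ hc', diagCoeff_of_not_isFree σ (mt isFree_flip.1 hc')]
    ring
  by_cases hcc : c = c'
  · subst hcc
    have : diagCoeff σ c x * diagCoeff σ c (flip c x) = 0 := by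
      rw [diagCoeff_of_isFree σ hc, diagCoeff_of_isFree σ (isFree_flip.2 hc), flip_fst_self hc]
      cases x.1 c <;> simp
    rw [← mul_assoc, this]
    ring
  rw [flip_comm hcc hc hc']
  have : diagCoeff σ c x * diagCoeff σ c' (flip c x) =
      -(diagCoeff σ c' x * diagCoeff σ c (flip c' x)) := by
    rw [diagCoeff_of_isFree σ hc, diagCoeff_of_isFree σ hc',
      diagCoeff_of_isFree σ (isFree_flip.2 hc), diagCoeff_of_isFree σ (isFree_flip.2 hc'),
      flip_fst_of_ne hc (Ne.symm hcc), flip_fst_of_ne hc' hcc, edgeSign_flip hc,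
      edgeSign_flip hc', colour_flip, colour_flip]
    rcases lt_or_gt_of_ne hcc with h | h
    · rw [if_pos h, if_neg h.not_gt]
      split_ifs <;> ring
    · rw [if_pos h, if_neg h.not_gt]
      split_ifs <;> ring
  rw [← mul_assoc, this]
  ring

/-- The homotopy identity, one crossing `c` at a time; `c₀` is the first free crossing. -/
theorem homotopyCoeff_add (hσ : ∀ a, σ a ≠ 0) {c₀ : Fin D.n} {x : D.EnhancedState}
    (h0 : IsFree x c₀) (hmin : ∀ j < c₀, ¬ IsFree x j) (c : Fin D.n) (v : D.EnhancedState → K) :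
    homotopyCoeff σ c₀ x * (diagCoeff σ c (flip c₀ x) * v (flip c (flip c₀ x))) +
      diagCoeff σ c x * (homotopyCoeff σ c₀ (flip c x) * v (flip c₀ (flip c x))) =
      if c = c₀ then v x else 0 := by
  have hmin' : ∀ j < c₀, ¬ IsFree (flip c x) j := fun j hj => mt isFree_flip.1 (hmin j hj)
  by_cases hc : IsFree x c
  swap
  · rw [diagCoeff_of_not_isFree σ hc, diagCoeff_of_not_isFree σ (mt isFree_flip.1 hc), if_neg]
    · ring
    · rintro rfl
      exact hc h0
  by_cases hcc : c = c₀
  · subst hcc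
    rw [if_pos rfl, flip_flip h0]
    rw [homotopyCoeff_of_first σ h0 hmin, diagCoeff_of_isFree σ h0,
      homotopyCoeff_of_first σ (isFree_flip.2 h0) hmin', diagCoeff_of_isFree σ (isFree_flip.2 h0),
      flip_fst_self h0, edgeSign_flip h0, if_neg (lt_irrefl c), colour_flip]
    have h1 : edgeSign K x.1 c * edgeSign K x.1 c = 1 := edgeSign_mul_self _ _
    have h2 := mul_inv_cancel₀ (hσ (colour x (c, 0)))
    cases x.1 c
    · simp only [Bool.not_false, if_true, reduceCtorEq, if_false, zero_mul, add_zero]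
      linear_combination (v x) * h1 * (σ (colour x (c, 0)) * (σ (colour x (c, 0)))⁻¹) + v x * h2
    · simp only [Bool.not_true, if_true, reduceCtorEq, if_false, zero_mul, zero_add]
      linear_combination (v x) * h1 * (σ (colour x (c, 0)) * (σ (colour x (c, 0)))⁻¹) + v x * h2
  · have hlt : c₀ < c := lt_of_le_of_ne (not_lt.1 fun h => hmin c h hc) (Ne.symm hcc)
    rw [if_neg hcc, flip_comm hcc hc h0]
    have : homotopyCoeff σ c₀ x * diagCoeff σ c (flip c₀ x) +
        diagCoeff σ c x * homotopyCoeff σ c₀ (flip c x) = 0 := by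
      rw [homotopyCoeff_of_first σ h0 hmin, diagCoeff_of_isFree σ hc,
        homotopyCoeff_of_first σ (isFree_flip.2 h0) hmin', diagCoeff_of_isFree σ (isFree_flip.2 hc),
        flip_fst_of_ne hc (Ne.symm hcc), flip_fst_of_ne h0 hcc, edgeSign_flip hc,
        edgeSign_flip h0, colour_flip, colour_flip, if_pos hlt, if_neg hlt.not_gt]
      split_ifs <;> ring
    rw [← mul_assoc, ← mul_assoc, ← add_mul, this, zero_mul]

end Homotopy

end LinkDiagram

/-! ### The change of basis -/

namespace LinkDiagram

variable {D : LinkDiagram}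

noncomputable instance (s : D.Vertex) : Fintype (Circle s) := Fintype.ofFinite _

noncomputable instance (s : D.Vertex) : DecidableEq (Circle s) := Classical.decEq _

/-- If one circle of `s'` contains both strands at `c` and two circles of `s` do, then the circles of
`s'` arise from those of `s` by merging these two. -/
theorem exists_isMerge {s s' : D.Vertex} {c : Fin D.n} (hs : ∀ j ≠ c, s j = s' j)
    (h : circleOf s (c, 0) ≠ circleOf s (c, 2)) (h' : circleOf s' (c, 0) = circleOf s' (c, 2)) :
    ∃ q : Circle s → Circle s', IsMerge q (circleOf s (c, 0)) (circleOf s (c, 2)) ∧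
      (∀ d, q (circleOf s d) = circleOf s' d) ∧ ∀ k, q (Sum.inr k) = Sum.inr k := by
  let q : Circle s → Circle s' := Sum.elim
    (Quot.lift (circleOf s') fun a b hab => circleOf_eq_of_circleOf_eq hs h'
      (congrArg Sum.inl (Quot.sound hab))) Sum.inr
  have hq : ∀ d, q (circleOf s d) = circleOf s' d := fun d => rfl
  have hk : ∀ k, q (Sum.inr k) = Sum.inr k := fun k => rfl
  refine ⟨q, ⟨?_, h, by rw [hq, hq, h'], ?_⟩, hq, hk⟩
  · intro b
    rcases exists_circleOf_eq_or_inr s' b with ⟨d, rfl⟩ | ⟨k, rfl⟩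
    exacts [⟨_, hq d⟩, ⟨_, hk k⟩]
  · intro a a' haa
    rcases exists_circleOf_eq_or_inr s a with ⟨d, rfl⟩ | ⟨k, rfl⟩ <;>
      rcases exists_circleOf_eq_or_inr s a' with ⟨d', rfl⟩ | ⟨k', rfl⟩
    · rw [hq, hq] at haa
      exact circleOf_eq_or_of_circleOf_eq hs haa
    · rw [hq, hk] at haa
      exact absurd haa (circleOf_ne_inr _ _ _)
    · rw [hq, hk] at haa
      exact absurd haa.symm (circleOf_ne_inr _ _ _)
    · rw [hk, hk] at haa
      exact Or.inl (congrArg Sum.inr (Sum.inr_injective haa))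

section Edge

variable {K : Type} [Field K] {t : K} (S : DiagonalBasis t)

open Classical in
/-- The matrix entry from `x` to `y` of the edge map at `c` in the diagonal basis. -/
noncomputable def diagEdge (σ : Bool → K) (c : Fin D.n) (y x : D.EnhancedState) : K :=
  if colour x = colour y ∧ loopColour x = loopColour y then σ (colour x (c, 0)) else 0

/-- The edge maps in the diagonal basis: both the multiplication and the comultiplication preserve
the colours of all darts, and scale by the eigenvalue of the colour at the crossing. -/
theorem sum_tensorPower_mul_edgeCoeff (c : Fin D.n) (s : D.Vertex) (hc : s c = false)
    (x : Circle s → Bool) (g : Circle (Function.update s c true) → Bool) :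
    ∑ y, tensorPower _ S.P g y * edgeCoeff t c ⟨s, x⟩ ⟨Function.update s c true, y⟩ =
      ∑ f, diagEdge S.σ c ⟨Function.update s c true, g⟩ ⟨s, f⟩ * tensorPower _ S.P f x := by
  classical
  have htoggle := circleOf_update_eq_iff s hc
  have hs : ∀ j ≠ c, s j = Function.update s c true j := fun j hj =>
    (Function.update_of_ne hj _ _).symm
  generalize Function.update s c true = s' at *
  by_cases h : circleOf s (c, 0) = circleOf s (c, 2)
  · have h' : circleOf s' (c, 0) ≠ circleOf s' (c, 2) := fun h1 => htoggle.1 h1 h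
    obtain ⟨q, hq, hqd, hqk⟩ := exists_isMerge (fun j hj => (hs j hj).symm) h' h
    have hedge : ∀ y, edgeCoeff t c ⟨s, x⟩ ⟨s', y⟩ =
        if ∀ a, a ≠ circleOf s' (c, 0) → a ≠ circleOf s' (c, 2) → y a = x (q a) then
          comulCoeff t (x (q (circleOf s' (c, 0)))) (y (circleOf s' (c, 0)))
            (y (circleOf s' (c, 2))) else 0 := by
      intro y
      unfold edgeCoeff
      rw [if_neg (c := circleOf s (c, 0) ≠ circleOf s (c, 2) ∧ _) fun h1 => h1.1 h,
        if_pos (c := circleOf s (c, 0) = circleOf s (c, 2) ∧ _) ⟨h, h'⟩, hqd]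
      congr 1
      apply propext
      constructor
      · rintro ⟨h1, h2⟩ a ha0 ha2
        rcases exists_circleOf_eq_or_inr s' a with ⟨d, rfl⟩ | ⟨k, rfl⟩
        · have hne := hq.map_ne ha0 ha2
          rw [hqd, hqd] at hne
          rw [hqd]
          exact h1 d hne (by rwa [← h])
        · rw [hqk]
          exact h2 k
      · intro h1
        refine ⟨fun d hd0 _ => ?_, fun k => ?_⟩
        · have := h1 (circleOf s' d) (fun h2 => hd0 (by rw [← hqd, h2, hqd]))
            (fun h2 => hd0 (by rw [← hqd, h2, hqd, h]))
          rwa [hqd] at this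
        · have := h1 (Sum.inr k) (circleOf_ne_inr _ _ _).symm (circleOf_ne_inr _ _ _).symm
          rwa [hqk] at this
    simp only [hedge]
    refine (hq.sum_comulCoeff S x g).trans ?_
    have hcond : ∀ f : Circle s → Bool, (colour (⟨s, f⟩ : D.EnhancedState) = colour ⟨s', g⟩ ∧
        loopColour (⟨s, f⟩ : D.EnhancedState) = loopColour ⟨s', g⟩) ↔ f ∘ q = g := by
      intro f
      constructor
      · rintro ⟨h1, h2⟩
        funext a
        rcases exists_circleOf_eq_or_inr s' a with ⟨d, rfl⟩ | ⟨k, rfl⟩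
        · rw [Function.comp_apply, hqd]
          exact congrFun h1 d
        · rw [Function.comp_apply, hqk]
          exact congrFun h2 k
      · rintro rfl
        refine ⟨funext fun d => ?_, funext fun k => ?_⟩
        · change f _ = f (q _)
          rw [hqd]
        · change f _ = f (q _)
          rw [hqk]
    by_cases hg : g (circleOf s' (c, 0)) = g (circleOf s' (c, 2))
    · obtain ⟨f, rfl⟩ : ∃ f : Circle s → Bool, f ∘ q = g := by
        refine ⟨fun b => g (Function.surjInv hq.surjective b), funext fun a => ?_⟩
        rw [Function.comp_apply]
        rcases hq.eq_or _ _ (Function.surjInv_eq hq.surjective (q a)) with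
          h1 | ⟨h1 | h1, h2 | h2⟩ <;> rw [h1]
        exacts [by rw [h2], by rw [h2, hg], by rw [h2, hg], by rw [h2]]
      rw [Finset.sum_eq_single f]
      · rw [if_pos hg, diagEdge, if_pos ((hcond f).2 rfl), tensorPower, Matrix.of_apply,
          hq.prod_right fun b => S.P (f b) (x b), mul_assoc]
        have : colour (⟨s, f⟩ : D.EnhancedState) (c, 0) = f (q (circleOf s' (c, 0))) := by
          rw [hqd]; rfl
        rw [this]
        rfl
      · intro f' _ hf'
        rw [diagEdge, if_neg, zero_mul]
        intro h1
        exact hf' (hq.surjective.injective_comp_right ((hcond f').1 h1))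
      · simp
    · rw [if_neg hg, zero_mul]
      symm
      refine Finset.sum_eq_zero fun f _ => ?_
      rw [diagEdge, if_neg, zero_mul]
      intro h1
      refine hg ?_
      rw [← (hcond f).1 h1, Function.comp_apply, Function.comp_apply, hq.map_eq]
  · have h' : circleOf s' (c, 0) = circleOf s' (c, 2) := htoggle.2 h
    obtain ⟨q, hq, hqd, hqk⟩ := exists_isMerge hs h h'
    have hedge : ∀ y, edgeCoeff t c ⟨s, x⟩ ⟨s', y⟩ =
        if ∀ a, a ≠ circleOf s (c, 0) → a ≠ circleOf s (c, 2) → y (q a) = x a then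
          mulCoeff t (x (circleOf s (c, 0))) (x (circleOf s (c, 2)))
            (y (q (circleOf s (c, 0)))) else 0 := by
      intro y
      unfold edgeCoeff
      rw [if_pos (c := circleOf s (c, 0) ≠ circleOf s (c, 2) ∧ _) ⟨h, h'⟩, hqd]
      congr 1
      apply propext
      constructor
      · rintro ⟨h1, h2⟩ a ha0 ha2
        rcases exists_circleOf_eq_or_inr s a with ⟨d, rfl⟩ | ⟨k, rfl⟩
        · rw [hqd]
          exact h1 d ha0 ha2
        · rw [hqk]
          exact h2 k
      · intro h1
        refine ⟨fun d hd0 hd2 => ?_, fun k => ?_⟩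
        · have := h1 (circleOf s d) hd0 hd2
          rwa [hqd] at this
        · have := h1 (Sum.inr k) (circleOf_ne_inr _ _ _).symm (circleOf_ne_inr _ _ _).symm
          rwa [hqk] at this
    simp only [hedge]
    refine (hq.sum_mulCoeff S x g).trans ?_
    have hcond : ∀ f : Circle s → Bool, (colour (⟨s, f⟩ : D.EnhancedState) = colour ⟨s', g⟩ ∧
        loopColour (⟨s, f⟩ : D.EnhancedState) = loopColour ⟨s', g⟩) ↔ f = g ∘ q := by
      intro f
      constructor
      · rintro ⟨h1, h2⟩
        funext a
        rcases exists_circleOf_eq_or_inr s a with ⟨d, rfl⟩ | ⟨k, rfl⟩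
        · rw [Function.comp_apply, hqd]
          exact congrFun h1 d
        · rw [Function.comp_apply, hqk]
          exact congrFun h2 k
      · rintro rfl
        refine ⟨funext fun d => ?_, funext fun k => ?_⟩
        · change g (q _) = g _
          rw [hqd]
        · change g (q _) = g _
          rw [hqk]
    rw [Finset.sum_eq_single (g ∘ q)]
    · rw [diagEdge, if_pos ((hcond _).2 rfl)]
      rfl
    · intro f' _ hf'
      rw [diagEdge, if_neg (fun h1 => hf' ((hcond f').1 h1)), zero_mul]
    · simp

end Edge

section ChangeOfBasis

variable {K : Type} [Field K]

/-- The matrix of a linear operator that maps a function `v` on states to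
`x ↦ ∑ c, a c x * v (flip c x)`. -/
noncomputable def flipMatrix (a : Fin D.n → D.EnhancedState → K) :
    Matrix D.EnhancedState D.EnhancedState K :=
  Matrix.of fun y x => ∑ c, if x = flip c y then a c y else 0

theorem flipMatrix_mulVec (a : Fin D.n → D.EnhancedState → K) (v : D.EnhancedState → K)
    (y : D.EnhancedState) : (flipMatrix a).mulVec v y = ∑ c, a c y * v (flip c y) := by
  simp only [flipMatrix, Matrix.mulVec, dotProduct, Matrix.of_apply, Finset.sum_mul]
  rw [Finset.sum_comm]
  refine Finset.sum_congr rfl fun c _ => ?_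
  rw [Finset.sum_eq_single (flip c y)]
  · rw [if_pos rfl]
  · intro x _ hx
    rw [if_neg hx, zero_mul]
  · simp

theorem exists_of_flipMatrix_ne_zero {a : Fin D.n → D.EnhancedState → K}
    {x y : D.EnhancedState} (h : flipMatrix a y x ≠ 0) : ∃ c, x = flip c y ∧ a c y ≠ 0 := by
  have h' : ∑ c, (if x = flip c y then a c y else 0) ≠ 0 := h
  obtain ⟨c, -, hc⟩ := Finset.exists_ne_zero_of_sum_ne_zero h'
  by_cases hx : x = flip c y
  · rw [if_pos hx] at hc
    exact ⟨c, hx, hc⟩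
  · rw [if_neg hx] at hc
    exact absurd rfl hc

/-- The differential in the diagonal basis. -/
noncomputable def diagMatrix (σ : Bool → K) : Matrix D.EnhancedState D.EnhancedState K :=
  flipMatrix (diagCoeff σ)

/-- The contracting homotopy in the diagonal basis. -/
noncomputable def homotopyMatrix (σ : Bool → K) : Matrix D.EnhancedState D.EnhancedState K :=
  flipMatrix (homotopyCoeff σ)

open Classical in
/-- The projection onto the states without free crossings. -/
noncomputable def survivorMatrix (D : LinkDiagram) (K : Type) [Field K] :
    Matrix D.EnhancedState D.EnhancedState K :=
  Matrix.diagonal fun x => if ∀ c, ¬ IsFree x c then 1 else 0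

theorem eq_of_mulVec_eq {G : Type*} [Fintype G] [DecidableEq G] {A B : Matrix G G K}
    (h : ∀ v x, A.mulVec v x = B.mulVec v x) : A = B :=
  Matrix.ext_of_mulVec_single fun _ => funext fun x => h _ x

theorem diagMatrix_mul_self [CharZero K] (σ : Bool → K) :
    (diagMatrix σ : Matrix D.EnhancedState D.EnhancedState K) * diagMatrix σ = 0 := by
  refine eq_of_mulVec_eq fun v x => ?_
  rw [← Matrix.mulVec_mulVec, Matrix.zero_mulVec, Pi.zero_apply]
  simp only [diagMatrix, flipMatrix_mulVec, Finset.mul_sum]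
  -- The double sum is antisymmetric in the two crossings.
  refine self_eq_neg.1 ?_
  conv_rhs => rw [Finset.sum_comm]
  rw [← Finset.sum_neg_distrib]
  refine Finset.sum_congr rfl fun c _ => ?_
  rw [← Finset.sum_neg_distrib]
  exact Finset.sum_congr rfl fun c' _ => diagCoeff_mul_diagCoeff_flip σ c c' x v

theorem diagMatrix_homotopy {σ : Bool → K} (hσ : ∀ a, σ a ≠ 0) :
    (diagMatrix σ : Matrix D.EnhancedState D.EnhancedState K) * homotopyMatrix σ +
      homotopyMatrix σ * diagMatrix σ + survivorMatrix D K = 1 := by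
  classical
  refine eq_of_mulVec_eq fun v x => ?_
  rw [Matrix.add_mulVec, Matrix.add_mulVec, ← Matrix.mulVec_mulVec, ← Matrix.mulVec_mulVec,
    Matrix.one_mulVec, Pi.add_apply, Pi.add_apply, survivorMatrix, Matrix.mulVec_diagonal]
  simp only [diagMatrix, homotopyMatrix, flipMatrix_mulVec]
  by_cases hx : ∀ c, ¬ IsFree x c
  · rw [if_pos hx, Finset.sum_eq_zero fun c _ => by
      rw [diagCoeff_of_not_isFree σ (hx c), zero_mul], Finset.sum_eq_zero fun c _ => by
      rw [homotopyCoeff_of_not_isFree σ (hx c), zero_mul]]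
    ring
  · rw [if_neg hx, zero_mul, add_zero]
    push Not at hx
    have hwf : ∃ c₀, IsFree x c₀ ∧ ∀ j < c₀, ¬ IsFree x j := by
      obtain ⟨c₀, h0, hmin⟩ := WellFounded.has_min (wellFounded_lt (α := Fin D.n))
        {c | IsFree x c} hx
      exact ⟨c₀, h0, fun j hj hf => hmin j hf hj⟩
    obtain ⟨c₀, h0, hmin⟩ := hwf
    have hzero : ∀ y : D.EnhancedState, colour y = colour x → ∀ j ≠ c₀,
        homotopyCoeff σ j y = 0 := by
      intro y hy j hj
      by_contra hne
      obtain ⟨-, h1, h2⟩ := homotopyCoeff_ne_zero σ hne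
      rw [isFree_congr hy] at h1
      rcases lt_or_gt_of_ne hj with h3 | h3
      · exact hmin j h3 h1
      · exact h2 c₀ h3 ((isFree_congr hy _).2 h0)
    have hsum : ∀ y : D.EnhancedState, colour y = colour x → ∀ w : Fin D.n → K,
        ∑ j, homotopyCoeff σ j y * w j = homotopyCoeff σ c₀ y * w c₀ := by
      intro y hy w
      refine Finset.sum_eq_single c₀ (fun j _ hj => ?_) (by simp)
      rw [hzero y hy j hj, zero_mul]
    rw [hsum x rfl, Finset.mul_sum]
    simp only [hsum _ colour_flip]
    rw [← Finset.sum_add_distrib, Finset.sum_congr rfl fun c _ => (add_comm _ _).trans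
      (homotopyCoeff_add σ hσ h0 hmin c v), Finset.sum_ite_eq' Finset.univ c₀,
      if_pos (Finset.mem_univ _)]

theorem survivorMatrix_mul_diagMatrix (σ : Bool → K) :
    survivorMatrix D K * diagMatrix σ = 0 := by
  classical
  ext y x
  rw [survivorMatrix, Matrix.diagonal_mul, Matrix.zero_apply]
  by_contra h
  obtain ⟨c, -, hc⟩ := exists_of_flipMatrix_ne_zero (right_ne_zero_of_mul h)
  refine left_ne_zero_of_mul h (if_neg fun h1 => h1 c (diagCoeff_ne_zero σ hc).2)

theorem diagMatrix_mul_survivorMatrix (σ : Bool → K) :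
    diagMatrix σ * survivorMatrix D K = 0 := by
  classical
  ext y x
  rw [survivorMatrix, Matrix.mul_diagonal, Matrix.zero_apply]
  by_contra h
  obtain ⟨c, rfl, hc⟩ := exists_of_flipMatrix_ne_zero (left_ne_zero_of_mul h)
  refine right_ne_zero_of_mul h (if_neg fun h1 => h1 c (isFree_flip.2 (diagCoeff_ne_zero σ hc).2))

theorem survivorMatrix_mul_self : survivorMatrix D K * survivorMatrix D K = survivorMatrix D K := by
  classical
  rw [survivorMatrix, Matrix.diagonal_mul_diagonal]
  congr 1
  funext x
  split_ifs <;> simp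

/-- The block diagonal matrix of the tensor powers of `P`. -/
noncomputable def vertexMatrix (D : LinkDiagram) (P : Matrix Bool Bool K) :
    Matrix D.EnhancedState D.EnhancedState K :=
  Matrix.blockDiagonal' fun s => tensorPower (Circle s) P

theorem vertexMatrix_mul_eq_one {P Q : Matrix Bool Bool K} (h : P * Q = 1) :
    vertexMatrix D P * vertexMatrix D Q = 1 := by
  rw [vertexMatrix, vertexMatrix, ← Matrix.blockDiagonal'_mul]
  simp only [tensorPower_mul, h, tensorPower_one]
  exact Matrix.blockDiagonal'_one

/-- The matrix of the total differential. -/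
noncomputable def incidenceMatrix (D : LinkDiagram) {R : Type} [CommRing R] (t : R) :
    Matrix D.EnhancedState D.EnhancedState R :=
  Matrix.of fun y x => incidence t x y

theorem diagMatrix_apply (σ : Bool → K) (y x : D.EnhancedState) :
    diagMatrix σ y x = ∑ c, if x.1 c = false ∧ y.1 = Function.update x.1 c true then
      edgeSign K x.1 c * diagEdge σ c y x else 0 := by
  classical
  rw [diagMatrix, flipMatrix, Matrix.of_apply]
  refine Finset.sum_congr rfl fun c _ => ?_
  by_cases h : (x.1 c = false ∧ y.1 = Function.update x.1 c true) ∧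
      (colour x = colour y ∧ loopColour x = loopColour y)
  · obtain ⟨⟨h1, h2⟩, h3, h4⟩ := h
    have hy : y.1 c = true := by rw [h2, Function.update_self]
    obtain ⟨hf, hx⟩ := eq_flip_of_colour_eq hy
      (by rw [h2, Function.update_idem, ← h1, Function.update_eq_self]) h3 h4
    rw [if_pos hx, if_pos ⟨h1, h2⟩, diagEdge, if_pos ⟨h3, h4⟩, diagCoeff_of_isFree σ hf, if_pos hy,
      h3, hx, edgeSign_flip hf, if_neg (lt_irrefl c)]
  · have hr : (if x.1 c = false ∧ y.1 = Function.update x.1 c true then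
        edgeSign K x.1 c * diagEdge σ c y x else 0) = 0 := by
      by_cases h1 : x.1 c = false ∧ y.1 = Function.update x.1 c true
      · rw [if_pos h1, diagEdge, if_neg fun h2 => h ⟨h1, h2⟩, mul_zero]
      · rw [if_neg h1]
    rw [hr]
    by_contra hne
    have hx : x = flip c y := by
      by_contra hx
      exact hne (if_neg hx)
    rw [if_pos hx] at hne
    obtain ⟨hy, hf⟩ := diagCoeff_ne_zero σ hne
    refine h ⟨⟨?_, ?_⟩, ?_, ?_⟩
    · rw [hx, flip_fst_self hf, hy]; rfl
    · rw [hx, flip_fst hf, Function.update_idem, ← hy, Function.update_eq_self]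
    · rw [hx, colour_flip]
    · rw [hx, loopColour_flip]

/-- The change of basis transforms the differential into a diagonal one. -/
theorem diagMatrix_mul_vertexMatrix {t : K} (S : DiagonalBasis t) :
    diagMatrix S.σ * vertexMatrix D S.P = vertexMatrix D S.P * incidenceMatrix D t := by
  ext ⟨s', g⟩ ⟨s, x⟩
  have hl : (diagMatrix S.σ * vertexMatrix D S.P : Matrix D.EnhancedState _ K) ⟨s', g⟩ ⟨s, x⟩ =
      ∑ f, diagMatrix S.σ ⟨s', g⟩ ⟨s, f⟩ * tensorPower _ S.P f x := by
    rw [Matrix.mul_apply, Fintype.sum_sigma, Finset.sum_eq_single s]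
    · refine Finset.sum_congr rfl fun f _ => ?_
      rw [vertexMatrix, Matrix.blockDiagonal'_apply_eq]
    · intro s₁ _ hs₁
      refine Finset.sum_eq_zero fun f _ => ?_
      rw [vertexMatrix, Matrix.blockDiagonal'_apply_ne _ _ _ hs₁, mul_zero]
    · simp
  have hr : (vertexMatrix D S.P * incidenceMatrix D t : Matrix D.EnhancedState _ K)
      ⟨s', g⟩ ⟨s, x⟩ =
      ∑ y, tensorPower _ S.P g y * incidence t ⟨s, x⟩ ⟨s', y⟩ := by
    rw [Matrix.mul_apply, Fintype.sum_sigma, Finset.sum_eq_single s']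
    · refine Finset.sum_congr rfl fun f _ => ?_
      rw [vertexMatrix, Matrix.blockDiagonal'_apply_eq]
      rfl
    · intro s₁ _ hs₁
      refine Finset.sum_eq_zero fun f _ => ?_
      rw [vertexMatrix, Matrix.blockDiagonal'_apply_ne _ _ _ hs₁.symm, zero_mul]
    · simp
  rw [hl, hr]
  simp only [diagMatrix_apply, incidence, Finset.sum_mul, Finset.mul_sum]
  rw [Finset.sum_comm, Finset.sum_comm (s := Finset.univ (α := Circle s' → Bool))]
  refine Finset.sum_congr rfl fun c _ => ?_
  by_cases h : s c = false ∧ s' = Function.update s c true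
  · obtain ⟨hc, rfl⟩ := h
    have key := sum_tensorPower_mul_edgeCoeff S c s hc x g
    simp only [hc, and_self, if_true]
    simp only [mul_assoc, mul_left_comm _ ((-1 : K) ^ _)]
    rw [← Finset.mul_sum, ← Finset.mul_sum, key]
    rfl
  · simp only [if_neg h, zero_mul, mul_zero, Finset.sum_const_zero]

end ChangeOfBasis

end LinkDiagram

/-! ### Degrees and ranks -/

namespace LinkDiagram

variable {D : LinkDiagram}

theorem card_update_true {n : ℕ} {s : Fin n → Bool} {c : Fin n} (hc : s c = false) :
    Nat.card {j // Function.update s c true j = true} = Nat.card {j // s j = true} + 1 := by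
  rw [Nat.card_eq_fintype_card, Nat.card_eq_fintype_card, Fintype.card_subtype,
    Fintype.card_subtype, ← Finset.card_insert_of_notMem (a := c) (by simp [hc])]
  congr 1
  ext j
  by_cases hj : j = c
  · subst hj
    simp
  · simp [hj]

theorem degree_eq_of_fst_eq {x y : D.EnhancedState} (h : x.1 = y.1) : degree x = degree y := by
  rw [degree, degree, h]

theorem degree_flip {c : Fin D.n} {x : D.EnhancedState} (h : IsFree x c) (hx : x.1 c = false) :
    degree (flip c x) = degree x + 1 := by
  rw [degree, degree, flip_fst h, hx, Bool.not_false, card_update_true hx]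
  push_cast
  ring

section Homogeneous

variable {K : Type} [Field K]

theorem isHomogeneousMatrix_vertexMatrix (P : Matrix Bool Bool K) :
    IsHomogeneousMatrix degree (vertexMatrix D P) 0 := by
  rintro ⟨s, f⟩ ⟨s', x⟩ h
  rw [add_zero]
  apply degree_eq_of_fst_eq
  by_contra hne
  exact h (Matrix.blockDiagonal'_apply_ne _ _ _ hne)

theorem isHomogeneousMatrix_survivorMatrix :
    IsHomogeneousMatrix degree (survivorMatrix D K) 0 := by
  intro y x h
  rw [add_zero]
  by_contra hne
  exact h (Matrix.diagonal_apply_ne _ fun h1 => hne (congrArg degree h1))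

theorem isHomogeneousMatrix_diagMatrix (σ : Bool → K) :
    IsHomogeneousMatrix (degree (D := D)) (diagMatrix σ) 1 := by
  intro y x h
  obtain ⟨c, rfl, hc⟩ := exists_of_flipMatrix_ne_zero h
  obtain ⟨h1, h2⟩ := diagCoeff_ne_zero σ hc
  rw [← degree_flip (isFree_flip.2 h2) (by rw [flip_fst_self h2, h1]; rfl), flip_flip h2]

theorem isHomogeneousMatrix_homotopyMatrix (σ : Bool → K) :
    IsHomogeneousMatrix (degree (D := D)) (homotopyMatrix σ) (-1) := by
  intro y x h
  obtain ⟨c, rfl, hc⟩ := exists_of_flipMatrix_ne_zero h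
  obtain ⟨h1, h2, -⟩ := homotopyCoeff_ne_zero σ hc
  rw [degree_flip h2 h1]
  ring

end Homogeneous

/-- Over an algebraically closed field, the total differential has degree `1` and square zero, and
the dimension of its cohomology in each degree is the number of states without free crossings: all
of this holds in the diagonal basis, and is carried over by the change of basis. -/
theorem incidenceMatrix_mul_self_and_card {K : Type} [Field K] [IsAlgClosed K] [CharZero K] {t : K}
    (ht : t ≠ 0) : IsHomogeneousMatrix degree (incidenceMatrix D t) 1 ∧
      incidenceMatrix D t * incidenceMatrix D t = 0 ∧
      ∀ i, Fintype.card (D.Generator i) =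
        (gradedBlock degree (incidenceMatrix D t) (i + 1) i).rank +
          (gradedBlock degree (incidenceMatrix D t) i (i - 1)).rank +
          Nat.card {x : D.Generator i // ∀ c, ¬ IsFree x.1 c} := by
  classical
  obtain ⟨S⟩ := nonempty_diagonalBasis ht
  set M := vertexMatrix D S.P with hM
  set N := vertexMatrix D S.inv with hN
  have hMN : M * N = 1 := vertexMatrix_mul_eq_one S.mul_inv
  have hNM : N * M = 1 := vertexMatrix_mul_eq_one (mul_eq_one_comm.1 S.mul_inv)
  have hI : incidenceMatrix D t = N * diagMatrix S.σ * M := by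
    rw [mul_assoc, diagMatrix_mul_vertexMatrix, ← mul_assoc, hNM, one_mul]
  have hconj : ∀ A B : Matrix D.EnhancedState D.EnhancedState K,
      N * A * M * (N * B * M) = N * (A * B) * M := by
    intro A B
    calc N * A * M * (N * B * M) = N * A * (M * N) * B * M := by simp only [mul_assoc]
      _ = _ := by rw [hMN, mul_one]; simp only [mul_assoc]
  have hhom : ∀ {A : Matrix D.EnhancedState D.EnhancedState K} {k : ℤ},
      IsHomogeneousMatrix degree A k → IsHomogeneousMatrix degree (N * A * M) k := by
    intro A k hA
    have := ((isHomogeneousMatrix_vertexMatrix S.inv).mul hA).mul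
      (isHomogeneousMatrix_vertexMatrix S.P)
    rwa [add_zero, zero_add] at this
  have hsq : incidenceMatrix D t * incidenceMatrix D t = 0 := by
    rw [hI, hconj, diagMatrix_mul_self, mul_zero, zero_mul]
  have hdeg : IsHomogeneousMatrix degree (incidenceMatrix D t) 1 := by
    rw [hI]
    exact hhom (isHomogeneousMatrix_diagMatrix _)
  refine ⟨hdeg, hsq, fun i => ?_⟩
  have key := card_eq_rank_add_rank_add_rank (deg := degree) (A := incidenceMatrix D t)
    (H := N * homotopyMatrix S.σ * M) (Q := N * survivorMatrix D K * M)
    hdeg (hhom (isHomogeneousMatrix_homotopyMatrix _)) (hhom isHomogeneousMatrix_survivorMatrix) hsq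
    (by
      rw [hI, hconj, hconj, ← add_mul, ← mul_add, ← add_mul, ← mul_add,
        diagMatrix_homotopy S.σ_ne_zero, mul_one, hNM])
    (by rw [hI, hconj, survivorMatrix_mul_diagMatrix, mul_zero, zero_mul])
    (by rw [hI, hconj, diagMatrix_mul_survivorMatrix, mul_zero, zero_mul])
    (by rw [hconj, survivorMatrix_mul_self]) i
  rw [key]
  congr 1
  have hMi : gradedBlock degree M i i * gradedBlock degree N i i = 1 := by
    rw [← gradedBlock_mul M (isHomogeneousMatrix_vertexMatrix S.inv) i (add_zero i).symm, hMN]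
    exact Matrix.submatrix_one _ Subtype.val_injective
  rw [gradedBlock_mul _ (isHomogeneousMatrix_vertexMatrix S.P) i (add_zero i).symm,
    gradedBlock_mul _ isHomogeneousMatrix_survivorMatrix i (add_zero i).symm,
    Matrix.rank_mul_eq_left_of_isUnit_det _ _
      (Matrix.isUnit_det_of_right_inverse hMi),
    Matrix.rank_mul_eq_right_of_isUnit_det _ _
      (Matrix.isUnit_det_of_left_inverse hMi)]
  have hdiag : gradedBlock degree (survivorMatrix D K) i i =
      Matrix.diagonal fun x : D.Generator i => if ∀ c, ¬ IsFree x.1 c then (1 : K) else 0 :=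
    Matrix.submatrix_diagonal _ _ Subtype.val_injective
  rw [hdiag, Matrix.rank_diagonal, Nat.card_eq_fintype_card]
  refine Fintype.card_congr (Equiv.subtypeEquivRight fun x => ?_)
  simp

/-! ### Extension of scalars -/

section Map

variable {R K : Type} [CommRing R] [CommRing K] (f : R →+* K) (t : R)

theorem map_mulCoeff (a b c : Bool) : f (mulCoeff t a b c) = mulCoeff (f t) a b c := by
  cases a <;> cases b <;> cases c <;> simp [mulCoeff]

theorem map_comulCoeff (a b c : Bool) : f (comulCoeff t a b c) = comulCoeff (f t) a b c := by
  cases a <;> cases b <;> cases c <;> simp [comulCoeff]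

theorem map_edgeCoeff (c : Fin D.n) (x y : D.EnhancedState) :
    f (edgeCoeff t c x y) = edgeCoeff (f t) c x y := by
  classical
  unfold edgeCoeff
  rw [apply_ite f, apply_ite f, apply_ite f, map_mulCoeff, map_comulCoeff, map_zero]

theorem map_incidence (x y : D.EnhancedState) : f (incidence t x y) = incidence (f t) x y := by
  unfold incidence
  rw [map_sum]
  refine Finset.sum_congr rfl fun c _ => ?_
  rw [apply_ite f, map_mul, map_pow, map_neg, map_one, map_zero, map_edgeCoeff]

theorem incidenceMatrix_map : (incidenceMatrix D t).map f = incidenceMatrix D (f t) :=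
  Matrix.ext fun y x => map_incidence f t x y

end Map

/-! ### Counting the states without free crossings -/

theorem isOut_opp {n : ℕ} (positive : Fin n → Bool) (d : Dart n) :
    IsOut positive (opp d) ↔ ¬ IsOut positive d := by
  obtain ⟨c, i⟩ := d
  change (i + 2 = 2 ∨ i + 2 = (if positive c then 1 else 3)) ↔
    ¬ (i = 2 ∨ i = (if positive c then 1 else 3))
  generalize positive c = b
  revert b i
  decide

/-- Lee's canonical colouring: the checkerboard colouring, corrected by the orientation of the link,
is constant along the arcs and changes between the two ends of a strand at a crossing. -/
theorem exists_canonicalColouring (D : LinkDiagram) :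
    ∃ φ : Dart D.n → Bool, (∀ d, φ (D.arc d) = φ d) ∧ ∀ d, φ (opp d) = !φ d := by
  classical
  obtain ⟨h, harc, hrot⟩ := exists_checkerboard D
  refine ⟨fun d => xor (h d) (decide (IsOut D.positive d)), fun d => ?_, fun d => ?_⟩
  · simp only [harc, D.oriented, decide_not]
    cases h d <;> simp
  · simp only [checkerboard_opp hrot, isOut_opp, decide_not]
    cases h d <;> simp

theorem forall_not_isFree_iff (x : D.EnhancedState) :
    (∀ c, ¬ IsFree x c) ↔ ∀ d, colour x (opp d) = !colour x d := by
  constructor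
  · rintro h ⟨c, i⟩
    have h0 : colour x (c, 2) = !colour x (c, 0) := by
      have := h c
      rw [IsFree] at this
      revert this
      cases colour x (c, 0) <;> cases colour x (c, 2) <;> simp
    cases hs : x.1 c
    · have h1 : colour x (c, 1) = colour x (c, 0) := congrArg x.2 (circleOf_crossing_false hs).1
      have h3 : colour x (c, 3) = colour x (c, 2) := congrArg x.2 (circleOf_crossing_false hs).2
      fin_cases i
      · exact h0
      · change colour x (c, 3) = !colour x (c, 1)
        rw [h1, h3, h0]
      · change colour x (c, 0) = !colour x (c, 2)
        rw [h0, Bool.not_not]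
      · change colour x (c, 1) = !colour x (c, 3)
        rw [h1, h3, h0, Bool.not_not]
    · have h3 : colour x (c, 3) = colour x (c, 0) := congrArg x.2 (circleOf_crossing_true hs).1
      have h1 : colour x (c, 1) = colour x (c, 2) := congrArg x.2 (circleOf_crossing_true hs).2
      fin_cases i
      · exact h0
      · change colour x (c, 3) = !colour x (c, 1)
        rw [h1, h3, h0, Bool.not_not]
      · change colour x (c, 0) = !colour x (c, 2)
        rw [h0, Bool.not_not]
      · change colour x (c, 1) = !colour x (c, 3)
        rw [h1, h3, h0]
  · intro h c hc
    have := h (c, 0)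
    rw [show opp (c, (0 : Fin 4)) = (c, 2) from rfl, ← show colour x (c, 0) = colour x (c, 2) from hc]
      at this
    revert this
    cases colour x (c, 0) <;> simp

/-- The smoothing of a state without free crossings is determined by the colours. -/
theorem fst_eq_xor_colour {x : D.EnhancedState} (h : ∀ d, colour x (opp d) = !colour x d)
    (c : Fin D.n) : x.1 c = xor (colour x (c, 0)) (colour x (c, 1)) := by
  have h0 : colour x (c, 2) = !colour x (c, 0) := h (c, 0)
  cases hs : x.1 c
  · rw [show colour x (c, 1) = colour x (c, 0) from congrArg x.2 (circleOf_crossing_false hs).1]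
    simp
  · rw [show colour x (c, 1) = colour x (c, 2) from congrArg x.2 (circleOf_crossing_true hs).2, h0]
    simp

/-- The states without free crossings form a torsor under the functions on the components of the
link; they correspond to the orientations of the link. -/
theorem card_survivors (D : LinkDiagram) :
    Nat.card {x : D.EnhancedState // ∀ c, ¬ IsFree x c} = 2 ^ D.numComponents := by
  classical
  obtain ⟨φ, harc, hopp⟩ := exists_canonicalColouring D
  have hfun : Nat.card (D.Component → Bool) = 2 ^ D.numComponents := by
    rw [Nat.card_fun, Nat.card_eq_fintype_card (α := Bool), Fintype.card_bool, numComponents]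
  rw [← hfun]
  simp only [forall_not_isFree_iff]
  let F : {x : D.EnhancedState // ∀ d, colour x (opp d) = !colour x d} → D.Component → Bool :=
    fun x => Sum.elim (Quot.lift (fun d => xor (colour x.1 d) (φ d)) (by
      rintro d _ (rfl | rfl)
      · simp only [colour_arc, harc]
      · simp only [x.2, hopp, Bool.not_xor_not])) (loopColour x.1)
  refine Nat.card_congr (Equiv.ofBijective F ⟨?_, ?_⟩)
  · intro x y hxy
    have hcol : colour x.1 = colour y.1 := by
      funext d
      have : xor (colour x.1 d) (φ d) = xor (colour y.1 d) (φ d) :=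
        congrFun hxy (Sum.inl (Quot.mk _ d))
      simpa using this
    refine Subtype.ext (enhancedState_ext (funext fun c => ?_) hcol
      (funext fun k => congrFun hxy (Sum.inr k)))
    rw [fst_eq_xor_colour x.2, fst_eq_xor_colour y.2, hcol]
  · intro u
    let ψ : Dart D.n → Bool := fun d => xor (u (Sum.inl (Quot.mk _ d))) (φ d)
    have hψa : ∀ d, ψ (D.arc d) = ψ d := by
      intro d
      have : (Quot.mk (fun d d' : Dart D.n => d' = D.arc d ∨ d' = opp d) (D.arc d)) = Quot.mk _ d :=
        (Quot.sound (r := fun d d' => d' = D.arc d ∨ d' = opp d) (Or.inl rfl)).symm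
      simp only [ψ, this, harc]
    have hψo : ∀ d, ψ (opp d) = !ψ d := by
      intro d
      have : (Quot.mk (fun d d' : Dart D.n => d' = D.arc d ∨ d' = opp d) (opp d)) = Quot.mk _ d :=
        (Quot.sound (r := fun d d' => d' = D.arc d ∨ d' = opp d) (Or.inr rfl)).symm
      simp only [ψ, this, hopp, Bool.xor_not]
    let s : D.Vertex := fun c => xor (ψ (c, 0)) (ψ (c, 1))
    have hs : ∀ d, ψ (smooth s d) = ψ d := by
      rintro ⟨c, i⟩
      have h2 : ψ (c, 2) = !ψ (c, 0) := hψo (c, 0)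
      have h3 : ψ (c, 3) = !ψ (c, 1) := hψo (c, 1)
      cases hsc : s c
      · have h1 : ψ (c, 0) = ψ (c, 1) := by simpa [s] using hsc
        rw [smooth_false hsc]
        fin_cases i
        · exact h1.symm
        · exact h1
        · change ψ (c, 3) = ψ (c, 2)
          rw [h2, h3, h1]
        · change ψ (c, 2) = ψ (c, 3)
          rw [h2, h3, h1]
      · have h1 : ψ (c, 0) = !ψ (c, 1) := by
          rw [Bool.eq_not]
          simpa [s] using hsc
        rw [smooth_true hsc]
        fin_cases i
        · change ψ (c, 3) = ψ (c, 0)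
          rw [h3, h1]
        · change ψ (c, 2) = ψ (c, 1)
          rw [h2, h1, Bool.not_not]
        · change ψ (c, 1) = ψ (c, 2)
          rw [h2, h1, Bool.not_not]
        · change ψ (c, 0) = ψ (c, 3)
          rw [h3, h1]
    obtain ⟨x, -, hx, hl⟩ := exists_enhancedState s ψ (fun k => u (Sum.inr k)) hψa hs
    refine ⟨⟨x, fun d => by rw [hx, hψo]⟩, funext fun a => ?_⟩
    rcases a with a | k
    · obtain ⟨d, rfl⟩ := Quot.exists_rep a
      change xor (colour x d) (φ d) = _
      rw [hx]
      simp only [ψ, Bool.xor_assoc, Bool.xor_self, Bool.xor_false]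
    · exact congrFun hl k

/-! ### The cohomology over the polynomial ring -/

section Cohomology

variable {R : Type} [CommRing R] [IsDomain R] [IsNoetherianRing R]

instance (t : R) (i : ℤ) : Module.Finite R (D.Cohomology t i) :=
  inferInstanceAs (Module.Finite R (LinearMap.ker (D.differential t i (i + 1)) ⧸
    (LinearMap.range (D.differential t (i - 1) i)).submoduleOf
      (LinearMap.ker (D.differential t i (i + 1)))))

omit [IsDomain R] [IsNoetherianRing R] in
theorem subsingleton_cohomology (t : R) {i : ℤ} (hi : IsEmpty (D.Generator i)) :
    Subsingleton (D.Cohomology t i) :=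
  inferInstanceAs (Subsingleton (LinearMap.ker (D.differential t i (i + 1)) ⧸
    (LinearMap.range (D.differential t (i - 1) i)).submoduleOf
      (LinearMap.ker (D.differential t i (i + 1)))))

instance finite_totalCohomology (t : R) : Module.Finite R (D.TotalCohomology t) := by
  classical
  refine DirectSum.finite_of_finite_nontrivial _
    (Finset.univ.image (degree : D.EnhancedState → ℤ)) fun i hi => ?_
  refine subsingleton_cohomology t ⟨fun x => hi ?_⟩
  exact Finset.mem_image.2 ⟨x.1, Finset.mem_univ _, x.2⟩

/-- The rank of the cohomology in each degree is the number of states without free crossings. -/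
theorem rank_cohomology {K : Type} [Field K] [IsAlgClosed K] [CharZero K] [Algebra R K]
    [FaithfulSMul R K] [Module.Flat R K] {t : R} (ht : t ≠ 0) (i : ℤ) :
    Module.rank R (D.Cohomology t i) =
      Nat.card {x : D.Generator i // ∀ c, ¬ IsFree x.1 c} := by
  have hinj : Function.Injective (algebraMap R K) := FaithfulSMul.algebraMap_injective R K
  obtain ⟨hdeg, hsq, hcard⟩ := incidenceMatrix_mul_self_and_card (D := D) (t := algebraMap R K t)
    ((map_ne_zero_iff _ hinj).2 ht)
  have hrank : ∀ j k, (gradedBlock degree (incidenceMatrix D (algebraMap R K t)) j k).rank =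
      Module.finrank R (LinearMap.range (D.differential t k j)) := by
    intro j k
    rw [← incidenceMatrix_map]
    exact Matrix.rank_map_algebraMap (gradedBlock degree (incidenceMatrix D t) j k)
  have hdegR : IsHomogeneousMatrix degree (incidenceMatrix D t) 1 := by
    intro y x h
    refine hdeg y x ?_
    rw [← incidenceMatrix_map]
    exact (map_ne_zero_iff _ hinj).2 h
  have hsqR : incidenceMatrix D t * incidenceMatrix D t = 0 := by
    refine Matrix.map_injective hinj ?_
    change (incidenceMatrix D t * incidenceMatrix D t).map (algebraMap R K) = Matrix.map 0 _
    rw [Matrix.map_mul, incidenceMatrix_map, hsq, Matrix.map_zero _ (map_zero _)]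
  refine rank_ker_quotient_range (D.differential t (i - 1) i) (D.differential t i (i + 1)) _ ?_ ?_
  · refine (Matrix.mulVecLin_mul (gradedBlock degree (incidenceMatrix D t) (i + 1) i)
      (gradedBlock degree (incidenceMatrix D t) i (i - 1))).symm.trans ?_
    rw [← gradedBlock_mul _ hdegR _ (by ring), hsqR]
    exact Matrix.mulVecLin_zero
  · rw [Module.finrank_fintype_fun_eq_card, hcard i, hrank, hrank]

theorem rank_totalCohomology {K : Type} [Field K] [IsAlgClosed K] [CharZero K] [Algebra R K]
    [FaithfulSMul R K] [Module.Flat R K] {t : R} (ht : t ≠ 0) :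
    Module.rank R (D.TotalCohomology t) = 2 ^ D.numComponents := by
  refine (rank_directSum_of_isDomain (D.Cohomology t)).trans ?_
  simp only [rank_cohomology (K := K) ht, Nat.cast_card]
  rw [← Cardinal.mk_sigma]
  have e : (Σ i, {x : D.Generator i // ∀ c, ¬ IsFree x.1 c}) ≃
      {x : D.EnhancedState // ∀ c, ¬ IsFree x c} :=
    { toFun := fun y => ⟨y.2.1.1, y.2.2⟩
      invFun := fun x => ⟨degree x.1, ⟨x.1, rfl⟩, x.2⟩
      left_inv := by
        rintro ⟨_, ⟨x, rfl⟩, h⟩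
        rfl
      right_inv := fun _ => rfl }
  rw [Cardinal.mk_congr e, ← Nat.cast_card, card_survivors]
  norm_cast

end Cohomology

end LinkDiagram

theorem mainTheorem6 (D : LinkDiagram) :
    Module.Free (Polynomial ℚ) D.HPrime ∧
      Module.rank (Polynomial ℚ) D.HPrime = 2 ^ D.numComponents := by
  have : FaithfulSMul (Polynomial ℚ) (AlgebraicClosure (FractionRing (Polynomial ℚ))) :=
    FaithfulSMul.trans _ (FractionRing (Polynomial ℚ)) _
  have : Module.Flat (Polynomial ℚ) (AlgebraicClosure (FractionRing (Polynomial ℚ))) :=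
    Module.Flat.trans _ (FractionRing (Polynomial ℚ)) _
  refine ⟨Module.free_of_finite_type_torsion_free', ?_⟩
  rw [rank_quotient_eq_of_le_torsion le_rfl]
  exact LinkDiagram.rank_totalCohomology
    (K := AlgebraicClosure (FractionRing (Polynomial ℚ))) Polynomial.X_ne_zero
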